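/- Let $M$ be a complex manifold of dimension $d$ with a smooth Hermitian metric $g$, let $0\le p\le d$, and let $A$ be a smooth bundle endomorphism of $\Lambda^{p,0}$, the bundle of $(p,0)$-forms, which is fibrewise self-adjoint for the Hermitian metric induced by $g$. Let $z_0\in M$ be a point at which the largest eigenvalue of $A$ has multiplicity one. Let $(U,z)$ be a holomorphic coordinate neighbourhood of $z_0$, write $g_{i\bar j}=\langle\partial_i,\partial_j\rangle$, and let $(a_K^L)$, with $K,L$ ranging over the $p$-element subsets of $\{1,\dots,d\}$, be the matrix of $A$ with respect to the basis $\{dz^K\}$, so that $A\,dz^L=\sum_K a_K^L\,dz^K$. Assume that $$g_{i\bar j}(z_0)=\delta_{ij},\qquad a_K^L(z_0)=\delta_K^L\,\lambda_K ,$$ and let $I$ be the index for which $\lambda_I$ is maximal. Then the eigenspaces $F_x\subset\Lambda^{p,0}_x$ of the largest eigenvalue of $A_x$ are one-dimensional for $x$ near $z_0$, and the section $$\Psi^F=|\psi|^{-2}\,\psi\otimes\psi^*$$ of $\Lambda^{p,0}\otimes(\Lambda^{p,0})^*$ is smooth near $z_0$; here $\psi$ is any nonzero element of $F_x$ and $\psi^*=\langle\,\cdot\,,\psi\rangle$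 is its metric dual, so that $\Psi^F$ is the orthogonal projection onto $F$. Moreover $$|\bar\partial\Psi^F|^2(z_0)=\sum_{J\ne I}(\lambda_I-\lambda_J)^{-2}\left(|\bar\partial a_I^J|^2+|\bar\partial a_J^I|^2\right)(z_0),$$ where $\bar\partial\Psi^F$ is taken in the holomorphic bundle $\Lambda^{p,0}\otimes(\Lambda^{p,0})^*$ and all norms are those induced by $g$. -/

import Mathlib

open Module
open scoped Manifold ContDiff ComplexConjugate

noncomputable section

/-! ### Hermitian linear algebra: the metric induced on `p`-forms -/

/-- The index set `binom([d], p)` of all `p`-element subsets of `{1, …, d}`. -/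
abbrev MultiIndex (d p : ℕ) : Type := Set.powersetCard (Fin d) p

/-- The elements `k₁ < ⋯ < k_p` of a multi-index `K`. -/
def MultiIndex.entry {d p : ℕ} (K : MultiIndex d p) : Fin p ↪o Fin d :=
  Set.powersetCard.ofFinEmbEquiv.symm K

/-- The minor `Q_{KL} = det (q_{kl})_{k ∈ K, l ∈ L}`. -/
def multiMinor {d p : ℕ} (Q : Matrix (Fin d) (Fin d) ℂ) (K L : MultiIndex d p) : ℂ :=
  (Q.submatrix K.entry L.entry).det

/-- The matrix `g_{i j̄} = h(b_i, b_j)` of a sesquilinear form (conjugate-linear in the second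
variable) with respect to the vectors `b_i`. -/
def gramOf {d : ℕ} {V : Type*} [AddCommGroup V] [Module ℂ V]
    (h : V →ₗ[ℂ] V →ₗ⋆[ℂ] ℂ) (b : Fin d → V) : Matrix (Fin d) (Fin d) ℂ :=
  Matrix.of fun i j => h (b i) (b j)

/-- The dual matrix `g^{i j̄}`, determined by `∑_q g^{p q̄} g_{k q̄} = δ^p_k`. -/
def dualMatrix {d : ℕ} (G : Matrix (Fin d) (Fin d) ℂ) : Matrix (Fin d) (Fin d) ℂ :=
  G⁻¹.transpose

/-- The Hermitian form induced by `h` on the alternating `ℂ`-multilinear `p`-forms on `V`,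
computed in a basis `b` of `V`: `⟨η, τ⟩ = ∑_{K,L} η_K conj(τ_L) g^{K L̄}`, where `η_K` is the value
of `η` at `(b_{k₁}, …, b_{k_p})` and `g^{K L̄}` is the minor of `g^{i j̄}`.
It does not depend on `b`, see `formPairing_basis_independent`. -/
def formPairing {d p : ℕ} {V : Type*} [AddCommGroup V] [Module ℂ V]
    (h : V →ₗ[ℂ] V →ₗ⋆[ℂ] ℂ) (b : Fin d → V) (η τ : V [⋀^Fin p]→ₗ[ℂ] ℂ) : ℂ :=
  ∑ K : MultiIndex d p, ∑ L : MultiIndex d p,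
    η (fun i => b (K.entry i)) * conj (τ (fun i => b (L.entry i))) *
      multiMinor (dualMatrix (gramOf h b)) K L

/-- Expansion of an alternating form in a basis. -/
theorem alternating_expand {d p : ℕ} {V : Type*} [AddCommGroup V] [Module ℂ V]
    (b : Basis (Fin d) ℂ V) (η : V [⋀^Fin p]→ₗ[ℂ] ℂ) (v : Fin p → V) :
    η v = ∑ K : MultiIndex d p, η (fun i => b (K.entry i)) *
      (Matrix.of fun i j : Fin p => b.repr (v j) (K.entry i)).det := by
  have h1 := (b.exteriorPower p).sum_repr (exteriorPower.ιMulti ℂ p v)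
  have h2 := congrArg (exteriorPower.alternatingMapLinearEquiv η) h1
  rw [exteriorPower.alternatingMapLinearEquiv_apply_ιMulti] at h2
  rw [← h2, map_sum]
  refine Finset.sum_congr rfl fun K _ => ?_
  rw [map_smul, exteriorPower.basis_apply, exteriorPower.basis_repr_apply,
    exteriorPower.ιMultiDual_apply_ιMulti, exteriorPower.ιMulti_family,
    exteriorPower.alternatingMapLinearEquiv_apply_ιMulti, smul_eq_mul, mul_comm,
    ← Matrix.det_transpose]
  rfl

/-- The Cauchy–Binet formula. -/
theorem multiMinor_mul {d p : ℕ} (P Q : Matrix (Fin d) (Fin d) ℂ) (K L : MultiIndex d p) :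
    multiMinor (P * Q) K L = ∑ N : MultiIndex d p, multiMinor P K N * multiMinor Q N L := by
  have key := alternating_expand (p := p) (Pi.basisFun ℂ (Fin d))
    ((Matrix.detRowAlternating (R := ℂ) (n := Fin p)).compLinearMap
      (LinearMap.pi fun i => (LinearMap.proj (K.entry i)).comp (Matrix.toLin' P)))
    (fun j => Q.col (L.entry j))
  have e1 : multiMinor (P * Q) K L =
      ((Matrix.detRowAlternating (R := ℂ) (n := Fin p)).compLinearMap
      (LinearMap.pi fun i => (LinearMap.proj (K.entry i)).comp (Matrix.toLin' P)))
        (fun j => Q.col (L.entry j)) := by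
    rw [multiMinor, ← Matrix.det_transpose]
    rfl
  rw [e1, key]
  refine Finset.sum_congr rfl fun N _ => ?_
  congr 1
  rw [multiMinor, ← Matrix.det_transpose]
  change Matrix.det _ = Matrix.det _
  congr 1
  ext i j
  simp [Matrix.mulVec_single]

/-- The induced form on `p`-forms does not depend on the basis. -/
theorem formPairing_basis_independent {d p : ℕ} {V : Type*} [AddCommGroup V] [Module ℂ V]
    (h : V →ₗ[ℂ] V →ₗ⋆[ℂ] ℂ) (b b' : Basis (Fin d) ℂ V)
    (η τ : V [⋀^Fin p]→ₗ[ℂ] ℂ) : formPairing h b η τ = formPairing h b' η τ := by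
  set P : Matrix (Fin d) (Fin d) ℂ := b.toMatrix b' with hP
  have hexp (σ : V [⋀^Fin p]→ₗ[ℂ] ℂ) (K : MultiIndex d p) :
      σ (fun i => b' (K.entry i)) =
        ∑ N : MultiIndex d p, σ (fun i => b (N.entry i)) * multiMinor P N K :=
    alternating_expand b σ _
  have hgram : gramOf h b' = P.transpose * gramOf h b * P.map conj := by
    ext i j
    have hi (k : Fin d) : b' k = ∑ l, P l k • b l := (b.sum_toMatrix_smul_self b' k).symm
    simp only [gramOf, Matrix.of_apply, Matrix.mul_apply, Matrix.transpose_apply, Matrix.map_apply]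
    rw [hi i, hi j]
    simp only [map_sum, map_smul, LinearMap.sum_apply, LinearMap.smul_apply, map_smulₛₗ,
      smul_eq_mul, Finset.sum_mul, Finset.mul_sum]
    refine Finset.sum_congr rfl fun k _ => Finset.sum_congr rfl fun l _ => ?_
    ring
  have hPu : IsUnit P.det := by
    have : P * b'.toMatrix b = 1 := b.toMatrix_mul_toMatrix_flip b'
    exact Matrix.isUnit_det_of_right_inverse this
  have hcu : IsUnit (P.map conj).det := by
    have : (P.map conj).det = conj P.det := (RingHom.map_det (starRingEnd ℂ) P).symm
    rw [this]
    exact hPu.map (starRingEnd ℂ)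
  have hdual : dualMatrix (gramOf h b) =
      P * dualMatrix (gramOf h b') * (P.map conj).transpose := by
    unfold dualMatrix
    rw [hgram, Matrix.mul_inv_rev, Matrix.mul_inv_rev, Matrix.transpose_mul,
      Matrix.transpose_mul, Matrix.transpose_nonsing_inv P.transpose, Matrix.transpose_transpose,
      Matrix.transpose_nonsing_inv (P.map conj)]
    have h2 : IsUnit ((P.map conj).transpose).det := by rwa [Matrix.det_transpose]
    rw [← Matrix.mul_assoc, ← Matrix.mul_assoc, Matrix.mul_nonsing_inv _ hPu, Matrix.one_mul,
      Matrix.mul_assoc, Matrix.nonsing_inv_mul _ h2, Matrix.mul_one]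
  have hconj (L N : MultiIndex d p) :
      multiMinor (P.map conj).transpose L N = conj (multiMinor P N L) := by
    unfold multiMinor
    rw [← Matrix.det_transpose]
    exact (RingHom.map_det (starRingEnd ℂ) (P.submatrix N.entry L.entry)).symm
  have swap (f : MultiIndex d p → MultiIndex d p → MultiIndex d p → MultiIndex d p → ℂ) :
      ∑ K, ∑ L, ∑ N, ∑ M, f K L N M = ∑ M, ∑ N, ∑ K, ∑ L, f K L N M := by
    calc ∑ K, ∑ L, ∑ N, ∑ M, f K L N M = ∑ K, ∑ N, ∑ M, ∑ L, f K L N M := by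
          refine Finset.sum_congr rfl fun K _ => ?_
          rw [Finset.sum_comm]
          exact Finset.sum_congr rfl fun N _ => Finset.sum_comm
      _ = ∑ N, ∑ M, ∑ K, ∑ L, f K L N M := by
          rw [Finset.sum_comm]
          exact Finset.sum_congr rfl fun N _ => Finset.sum_comm
      _ = _ := Finset.sum_comm
  unfold formPairing
  rw [hdual]
  simp only [multiMinor_mul, hexp, hconj, map_sum, map_mul, Finset.sum_mul, Finset.mul_sum]
  rw [swap]
  refine Finset.sum_congr rfl fun M _ => Finset.sum_congr rfl fun N _ => ?_
  rw [Finset.sum_comm]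
  refine Finset.sum_congr rfl fun L _ => Finset.sum_congr rfl fun K _ => ?_
  ring

/-- The rank-one endomorphism `|ψ|⁻² ψ ⊗ ψ^*` of the space of `p`-forms, where `ψ^* = ⟨·, ψ⟩` is the
metric dual of `ψ`. -/
def rankOneProj {d p : ℕ} {V : Type*} [AddCommGroup V] [Module ℂ V]
    (h : V →ₗ[ℂ] V →ₗ⋆[ℂ] ℂ) (b : Fin d → V) (ψ : V [⋀^Fin p]→ₗ[ℂ] ℂ) :
    End ℂ (V [⋀^Fin p]→ₗ[ℂ] ℂ) where
  toFun η := (formPairing h b η ψ / formPairing h b ψ ψ) • ψ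
  map_add' η η' := by
    rw [← add_smul, ← add_div]
    simp only [formPairing, AlternatingMap.add_apply, add_mul, Finset.sum_add_distrib]
  map_smul' c η := by
    rw [RingHom.id_apply, smul_smul, ← mul_div_assoc]
    simp only [formPairing, AlternatingMap.smul_apply, smul_eq_mul, Finset.mul_sum, mul_assoc]

open Classical in
/-- For a line `F` in the space of `p`-forms, the endomorphism `|ψ|⁻² ψ ⊗ ψ^*` for any nonzero
`ψ ∈ F`; the choice of `ψ` is irrelevant, see `lineProj_eq`. -/
def lineProj {d p : ℕ} {V : Type*} [AddCommGroup V] [Module ℂ V]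
    (h : V →ₗ[ℂ] V →ₗ⋆[ℂ] ℂ) (b : Fin d → V) (F : Submodule ℂ (V [⋀^Fin p]→ₗ[ℂ] ℂ)) :
    End ℂ (V [⋀^Fin p]→ₗ[ℂ] ℂ) :=
  if hF : ∃ ψ ∈ F, ψ ≠ 0 then rankOneProj h b hF.choose else 0

theorem lineProj_eq {d p : ℕ} {V : Type*} [AddCommGroup V] [Module ℂ V]
    (h : V →ₗ[ℂ] V →ₗ⋆[ℂ] ℂ) (b : Fin d → V) (F : Submodule ℂ (V [⋀^Fin p]→ₗ[ℂ] ℂ))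
    (hF : finrank ℂ F = 1) (ψ : V [⋀^Fin p]→ₗ[ℂ] ℂ) (hψ : ψ ∈ F) (hψ0 : ψ ≠ 0) :
    lineProj h b F = rankOneProj h b ψ := by
  have hex : ∃ ψ ∈ F, ψ ≠ 0 := ⟨ψ, hψ, hψ0⟩
  rw [lineProj, dif_pos hex]
  obtain ⟨h1, h2⟩ := hex.choose_spec
  set χ := hex.choose
  obtain ⟨c, hc⟩ := (finrank_eq_one_iff_of_nonzero' (⟨ψ, hψ⟩ : F) (by simpa using hψ0)).1 hF ⟨χ, h1⟩
  have hc' : c • ψ = χ := congrArg Subtype.val hc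
  have hc0 : c ≠ 0 := by
    rintro rfl
    exact h2 (by rw [← hc', zero_smul])
  have hR (η : V [⋀^Fin p]→ₗ[ℂ] ℂ) :
      formPairing h b η (c • ψ) = conj c * formPairing h b η ψ := by
    simp only [formPairing, AlternatingMap.smul_apply, smul_eq_mul, Finset.mul_sum, map_mul]
    refine Finset.sum_congr rfl fun K _ => Finset.sum_congr rfl fun L _ => ?_
    ring
  have hL (η : V [⋀^Fin p]→ₗ[ℂ] ℂ) :
      formPairing h b (c • ψ) η = c * formPairing h b ψ η := by
    simp only [formPairing, AlternatingMap.smul_apply, smul_eq_mul, Finset.mul_sum, mul_assoc]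
  have hcc : conj c ≠ 0 := by simpa using hc0
  apply LinearMap.ext
  intro η
  change (formPairing h b η χ / formPairing h b χ χ) • χ = (formPairing h b η ψ / _) • ψ
  rw [← hc', hR, hR, hL, smul_smul]
  congr 1
  rw [mul_div_mul_left _ _ hcc]
  by_cases h0 : formPairing h b ψ ψ = 0
  · simp [h0]
  · field_simp

/-- The largest real eigenvalue. -/
def topEigenvalue {W : Type*} [AddCommGroup W] [Module ℂ W] (T : End ℂ W) : ℝ :=
  sSup {r : ℝ | T.HasEigenvalue (r : ℂ)}

/-- The eigenspace of the largest real eigenvalue. -/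
def topEigenspace {W : Type*} [AddCommGroup W] [Module ℂ W] (T : End ℂ W) : Submodule ℂ W :=
  T.eigenspace (topEigenvalue T : ℂ)

/-! ### Forms and Hermitian metrics on a complex manifold -/

/-- The model space `ℂ^d`. -/
abbrev ModelSpace (d : ℕ) : Type := EuclideanSpace ℂ (Fin d)

/-- The holomorphic tangent space `T^{1,0}_x M`: the tangent space with its complex structure. -/
abbrev HolTangent (d : ℕ) {M : Type*} [TopologicalSpace M] [ChartedSpace (ModelSpace d) M]
    (x : M) : Type :=
  TangentSpace 𝓘(ℂ, ModelSpace d) x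

/-- The fibre `Λ^{p,0}_x` of the bundle of `(p,0)`-forms: alternating `ℂ`-multilinear `p`-forms on
`T^{1,0}_x M`. -/
abbrev HolForm (d p : ℕ) {M : Type*} [TopologicalSpace M] [ChartedSpace (ModelSpace d) M]
    (x : M) : Type :=
  HolTangent d x [⋀^Fin p]→ₗ[ℂ] ℂ

section Manifold

variable {d p : ℕ} {M : Type*} [TopologicalSpace M] [ChartedSpace (ModelSpace d) M]

/-- The standard basis of `T^{1,0}_x M` (the coordinate frame at `x` of the preferred chart
at `x`). -/
def tangentBasis (x : M) : Basis (Fin d) ℂ (HolTangent d x) :=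
  (EuclideanSpace.basisFun (Fin d) ℂ).toBasis

/-- `φ` is a holomorphic coordinate system on the open set `φ.source`. -/
def IsHolChart (φ : OpenPartialHomeomorph M (ModelSpace d)) : Prop :=
  φ ∈ IsManifold.maximalAtlas 𝓘(ℂ, ModelSpace d) ω M

/-- The coordinate vector `∂_i` at the point with coordinates `w`. -/
def coordVector (φ : OpenPartialHomeomorph M (ModelSpace d)) (i : Fin d) (w : ModelSpace d) :
    HolTangent d (φ.symm w) :=
  mfderiv 𝓘(ℂ, ModelSpace d) 𝓘(ℂ, ModelSpace d) φ.symm w (EuclideanSpace.single i (1 : ℂ))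

/-- The coordinate covector `dz^i` at `x`. -/
def coordCovector (φ : OpenPartialHomeomorph M (ModelSpace d)) (i : Fin d) (x : M) :
    HolTangent d x →ₗ[ℂ] ℂ :=
  (EuclideanSpace.proj i : ModelSpace d →L[ℂ] ℂ).toLinearMap.comp
    (mfderiv 𝓘(ℂ, ModelSpace d) 𝓘(ℂ, ModelSpace d) φ x).toLinearMap

/-- The coordinate form `dz^K = dz^{k₁} ∧ ⋯ ∧ dz^{k_p}` at `x`, that is
`dz^K(v₁, …, v_p) = det (dz^{k_i}(v_j))`. -/
def coordForm (φ : OpenPartialHomeomorph M (ModelSpace d)) (K : MultiIndex d p) (x : M) :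
    HolForm d p x :=
  (Matrix.detRowAlternating (R := ℂ) (n := Fin p)).compLinearMap
    (LinearMap.pi fun i => coordCovector φ (K.entry i) x)

/-- The coefficient `b_K^L` of `dz^K` in `B dz^L`, as a function of the coordinates. -/
def endCoeff (φ : OpenPartialHomeomorph M (ModelSpace d)) (B : ∀ x : M, End ℂ (HolForm d p x))
    (K L : MultiIndex d p) (w : ModelSpace d) : ℂ :=
  B (φ.symm w) (coordForm φ L (φ.symm w)) (fun i => coordVector φ (K.entry i) w)

/-- A family of endomorphisms of the fibres of `Λ^{p,0}` is smooth (in the real sense) on `U`: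
its coefficients in all holomorphic coordinates are smooth. -/
def SmoothEndOn (B : ∀ x : M, End ℂ (HolForm d p x)) (U : Set M) : Prop :=
  ∀ φ : OpenPartialHomeomorph M (ModelSpace d), IsHolChart φ → ∀ K L : MultiIndex d p,
    ContDiffOn ℝ ∞ (endCoeff φ B K L) (φ.target ∩ φ.symm ⁻¹' U)

variable (d M) in
/-- A smooth Hermitian metric on the complex manifold `M`. -/
structure HermitianMetric where
  /-- The Hermitian inner product, linear in the first and conjugate-linear in the second
  variable. -/
  inner : ∀ x : M, HolTangent d x →ₗ[ℂ] HolTangent d x →ₗ⋆[ℂ] ℂ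
  conj_symm : ∀ (x : M) (u v : HolTangent d x), conj (inner x u v) = inner x v u
  pos : ∀ (x : M) (u : HolTangent d x), u ≠ 0 → 0 < (inner x u u).re
  smooth : ∀ φ : OpenPartialHomeomorph M (ModelSpace d), IsHolChart φ → ∀ i j : Fin d,
    ContDiffOn ℝ ∞
      (fun w => inner (φ.symm w) (coordVector φ i w) (coordVector φ j w)) φ.target

namespace HermitianMetric

variable (g : HermitianMetric d M)

/-- The induced Hermitian inner product on `Λ^{p,0}_x`. -/
def formInner (x : M) (η τ : HolForm d p x) : ℂ :=
  formPairing (g.inner x) (tangentBasis x) η τ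

/-- A family of endomorphisms of the fibres of `Λ^{p,0}` is fibrewise self-adjoint. -/
def IsFibrewiseSelfAdjoint (A : ∀ x : M, End ℂ (HolForm d p x)) : Prop :=
  ∀ (x : M) (η τ : HolForm d p x), g.formInner x (A x η) τ = g.formInner x η (A x τ)

/-- The section `Ψ^F = |ψ|⁻² ψ ⊗ ψ^*` attached to a field of lines `F_x ⊂ Λ^{p,0}_x`. -/
def charSection (F : ∀ x : M, Submodule ℂ (HolForm d p x)) (x : M) : End ℂ (HolForm d p x) :=
  lineProj (g.inner x) (tangentBasis x) (F x)

/-- The matrix `g_{i j̄} = ⟨∂_i, ∂_j⟩` at the point with coordinates `w`. -/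
def coordMatrix (φ : OpenPartialHomeomorph M (ModelSpace d)) (w : ModelSpace d) :
    Matrix (Fin d) (Fin d) ℂ :=
  gramOf (g.inner (φ.symm w)) (fun i => coordVector φ i w)

end HermitianMetric

/-- The Wirtinger derivative `∂f/∂z̄_j = (∂f/∂x_j + √-1 ∂f/∂y_j) / 2`. -/
def dbar (j : Fin d) (f : ModelSpace d → ℂ) (w : ModelSpace d) : ℂ :=
  (1 / 2 : ℂ) * (fderiv ℝ f w (EuclideanSpace.single j (1 : ℂ)) +
    Complex.I * fderiv ℝ f w (EuclideanSpace.single j Complex.I))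

namespace HermitianMetric

variable (g : HermitianMetric d M) (φ : OpenPartialHomeomorph M (ModelSpace d))

/-- The squared norm `|∂̄f|² = ∑_{j,k} g^{k j̄} ∂_{j̄}f conj(∂_{k̄}f)` of the `(0,1)`-form `∂̄f`, for
a function `f` of the coordinates. -/
def normSqDbar (f : ModelSpace d → ℂ) (w : ModelSpace d) : ℝ :=
  (∑ j : Fin d, ∑ k : Fin d, dualMatrix (g.coordMatrix φ w) k j *
    (dbar j f w * conj (dbar k f w))).re

/-- The squared norm of `∂̄B = ∑ ∂_{j̄}B_K^L dz̄^j ⊗ dz^K ⊗ ∂_L` for a section `B = ∑ B_K^L dz^K ⊗ ∂_L`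
of the holomorphic bundle `Λ^{p,0} ⊗ (Λ^{p,0})^*`, in the metric induced by `g` on
`Λ^{0,1} ⊗ Λ^{p,0} ⊗ (Λ^{p,0})^*`:
`∑ g^{k j̄} g^{K N̄} g_{L R̄} ∂_{j̄}B_K^L conj(∂_{k̄}B_N^R)`. -/
def normSqDbarEnd (B : ∀ x : M, End ℂ (HolForm d p x)) (w : ModelSpace d) : ℝ :=
  (∑ j : Fin d, ∑ k : Fin d, ∑ K : MultiIndex d p, ∑ L : MultiIndex d p,
    ∑ N : MultiIndex d p, ∑ R : MultiIndex d p,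
      dualMatrix (g.coordMatrix φ w) k j *
      multiMinor (dualMatrix (g.coordMatrix φ w)) K N * multiMinor (g.coordMatrix φ w) L R *
      (dbar j (endCoeff φ B K L) w * conj (dbar k (endCoeff φ B N R) w))).re

end HermitianMetric

end Manifold

end

/-!
Near `z₀` the fibrewise problem is one about a smooth family of matrices `a`, the matrix of `A` in
the frame `dz^K`. Each fibre of `Λ^{p,0}` carries the inner product induced by `g` (`formCore`), for
which `A` is symmetric. Hence the spectrum is real, and geometric and algebraic multiplicities agree:
the largest eigenvalue `τ` is simple exactly when it is a root of the characteristic polynomial `χ`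
with `χ'(τ) ≠ 0` (`finrank_eigenspace_eq_one_iff`).

Smoothness of `τ` where it is simple follows from the implicit function theorem for `χ`, once `τ` is
known to be continuous: it is bounded below by the root continuing `τ(z₀)`, which is real, and
larger roots are excluded by compactness (`contDiffAt_top_charpoly_root`). Then `χ'(τ)` is smooth
too, so that it stays nonzero and the eigenspaces stay one-dimensional. The orthogonal projection
`Ψ` onto the eigenline is recovered without a choice of eigenvector: `adj (τ - a) = χ'(τ) Ψ`
(`adjugate_scalar_sub_toMatrix`) exhibits its coefficients as smooth functions of `a` and `τ`.

For the formula, `∂̄` is applied to `a Ψ = τ Ψ`, `Ψ a = τ Ψ` and `Ψ² = Ψ` at `z₀`, where `a` is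
diagonal and `Ψ` is the projection onto the axis `I`. This gives
`∂̄Ψ_J^I = (λ_I - λ_J)⁻¹ ∂̄a_J^I` and `∂̄Ψ_I^J = (λ_I - λ_J)⁻¹ ∂̄a_I^J` for `J ≠ I`, and zero for the
remaining coefficients (`dbarMatrix_projection`). As the frames are orthonormal at `z₀`, the norms
are sums of squares of coefficients.
-/

noncomputable section

/-! ### Simple eigenvalues of a symmetric endomorphism -/

section Symmetric

open scoped InnerProductSpace

variable {W : Type*} [NormedAddCommGroup W] [InnerProductSpace ℂ W] [FiniteDimensional ℂ W]
  {T : End ℂ W}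

theorem finrank_eigenspace_eq_rootMultiplicity (hT : LinearMap.IsSymmetric T) (μ : ℂ) :
    finrank ℂ (T.eigenspace μ) = T.charpoly.rootMultiplicity μ := by
  rw [← LinearMap.finrank_maxGenEigenspace_eq,
    hT.isFinitelySemisimple.maxGenEigenspace_eq_eigenspace]

/-- For a symmetric endomorphism the eigenvalues with one-dimensional eigenspace are the simple roots
of the characteristic polynomial. -/
theorem finrank_eigenspace_eq_one_iff (hT : LinearMap.IsSymmetric T) (μ : ℂ) :
    finrank ℂ (T.eigenspace μ) = 1 ↔
      T.charpoly.eval μ = 0 ∧ T.charpoly.derivative.eval μ ≠ 0 := by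
  have h0 : T.charpoly ≠ 0 := T.charpoly_monic.ne_zero
  rw [finrank_eigenspace_eq_rootMultiplicity hT]
  have h1 := Polynomial.rootMultiplicity_pos (x := μ) h0
  have h2 := Polynomial.one_lt_rootMultiplicity_iff_isRoot (t := μ) h0
  simp only [Polynomial.IsRoot.def] at h1 h2
  constructor
  · intro h
    exact ⟨h1.1 (by omega), fun h3 => by have := h2.2 ⟨h1.1 (by omega), h3⟩; omega⟩
  · rintro ⟨h3, h4⟩
    have := h1.2 h3
    have : ¬ 1 < T.charpoly.rootMultiplicity μ := fun h => h4 (h2.1 h).2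
    omega

theorem im_eq_zero_of_charpoly_eval_eq_zero (hT : LinearMap.IsSymmetric T) {μ : ℂ}
    (hμ : T.charpoly.eval μ = 0) : μ.im = 0 := by
  have h : T.HasEigenvalue μ := (End.hasEigenvalue_iff_isRoot_charpoly T μ).2 hμ
  exact Complex.conj_eq_iff_im.1 (hT.conj_eigenvalue_eq_self h)

theorem bddAbove_setOf_hasEigenvalue (T : End ℂ W) :
    BddAbove {r : ℝ | T.HasEigenvalue (r : ℂ)} := by
  have hfin : Set.Finite {μ : ℂ | T.HasEigenvalue μ} := T.finite_hasEigenvalue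
  exact (hfin.preimage (f := fun r : ℝ => (r : ℂ)) Complex.ofReal_injective.injOn).bddAbove

theorem hasEigenvalue_topEigenvalue [Nontrivial W] (hT : LinearMap.IsSymmetric T) :
    T.HasEigenvalue (topEigenvalue T : ℂ) := by
  have hfin : Set.Finite {r : ℝ | T.HasEigenvalue (r : ℂ)} :=
    (T.finite_hasEigenvalue).preimage (f := fun r : ℝ => (r : ℂ)) Complex.ofReal_injective.injOn
  have hne : Set.Nonempty {r : ℝ | T.HasEigenvalue (r : ℂ)} := by
    obtain ⟨μ, hμ⟩ := End.exists_eigenvalue T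
    refine ⟨μ.re, ?_⟩
    have := Complex.conj_eq_iff_re.1 (hT.conj_eigenvalue_eq_self hμ)
    rwa [Set.mem_ofPred_eq, this]
  exact hne.csSup_mem hfin

theorem re_le_topEigenvalue (hT : LinearMap.IsSymmetric T) {μ : ℂ} (hμ : T.HasEigenvalue μ) :
    μ.re ≤ topEigenvalue T := by
  refine le_csSup (bddAbove_setOf_hasEigenvalue T) ?_
  have := Complex.conj_eq_iff_re.1 (hT.conj_eigenvalue_eq_self hμ)
  rwa [Set.mem_ofPred_eq, this]

/-- The adjugate of `μ - T` acts on an eigenvector for `μ` as `χ'(μ)`, where `χ` is the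
characteristic polynomial: for `t ≠ μ` it acts as `χ(t) / (t - μ)`. -/
theorem Matrix.adjugate_scalar_sub_mulVec {n : Type*} [Fintype n] [DecidableEq n]
    (a : Matrix n n ℂ) (μ : ℂ) (v : n → ℂ) (hv : a.mulVec v = μ • v) (hv0 : v ≠ 0) :
    (Matrix.scalar n μ - a).adjugate.mulVec v = a.charpoly.derivative.eval μ • v := by
  have hsub (t : ℂ) : (Matrix.scalar n t - a).mulVec v = (t - μ) • v := by
    rw [Matrix.sub_mulVec, hv, sub_smul]
    simp [Matrix.scalar_apply, ← Matrix.smul_one_eq_diagonal, Matrix.smul_mulVec]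
  have hroot : a.charpoly.eval μ = 0 := by
    rw [Matrix.eval_charpoly]
    exact Matrix.exists_mulVec_eq_zero_iff.1 ⟨v, hv0, by rw [hsub, sub_self, zero_smul]⟩
  obtain ⟨q, hq⟩ := Polynomial.dvd_iff_isRoot.2 hroot
  have hder : a.charpoly.derivative.eval μ = q.eval μ := by
    rw [hq]
    simp
  have key (t : ℂ) (ht : t ∈ ({μ}ᶜ : Set ℂ)) :
      (Matrix.scalar n t - a).adjugate.mulVec v = q.eval t • v := by
    have ht' : t - μ ≠ 0 := sub_ne_zero.2 ht
    have h1 : (t - μ) • (Matrix.scalar n t - a).adjugate.mulVec v = (t - μ) • q.eval t • v := by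
      rw [← Matrix.mulVec_smul, ← hsub, Matrix.mulVec_mulVec, Matrix.adjugate_mul,
        ← Matrix.eval_charpoly, hq]
      simp [Matrix.smul_mulVec, smul_smul]
    exact smul_right_injective _ ht' h1
  have hc1 : Continuous fun t : ℂ => (Matrix.scalar n t - a).adjugate.mulVec v := by
    simp only [Matrix.scalar_apply]
    fun_prop
  have hc2 : Continuous fun t : ℂ => q.eval t • v := by fun_prop
  rw [hder]
  exact congrFun (hc1.ext_on (dense_compl_singleton μ) hc2 key) μ

/-- For a symmetric `T` with a simple eigenvalue `μ` the adjugate of `μ - T` is `χ'(μ)` times the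
orthogonal projection onto the eigenline. -/
theorem adjugate_scalar_sub_toMatrix (hT : LinearMap.IsSymmetric T) {μ : ℂ} (hμ : μ.im = 0)
    (hfin : finrank ℂ (T.eigenspace μ) = 1) {ψ : W} (hψ : ψ ∈ T.eigenspace μ) (hψ0 : ψ ≠ 0)
    {P : End ℂ W} (hP : ∀ η, P η = (⟪ψ, η⟫_ℂ / ⟪ψ, ψ⟫_ℂ) • ψ)
    {n : Type*} [Fintype n] [DecidableEq n] (b : Basis n ℂ W) :
    (Matrix.scalar n μ - LinearMap.toMatrix b b T).adjugate =
      T.charpoly.derivative.eval μ • LinearMap.toMatrix b b P := by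
  set a := LinearMap.toMatrix b b T with ha
  set C : End ℂ W := Matrix.toLin b b (Matrix.scalar n μ - a).adjugate with hC
  set S : End ℂ W := μ • LinearMap.id - T with hS
  have hSm : LinearMap.toMatrix b b S = Matrix.scalar n μ - a := by
    rw [hS, map_sub, map_smul, LinearMap.toMatrix_id, Matrix.scalar_apply,
      Matrix.smul_one_eq_diagonal]
  have hSsymm : LinearMap.IsSymmetric S := by
    intro x y
    simp only [hS, LinearMap.sub_apply, LinearMap.smul_apply, LinearMap.id_apply, inner_sub_left,
      inner_sub_right, inner_smul_left, inner_smul_right, hT x y, Complex.conj_eq_iff_im.2 hμ]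
  have hker : LinearMap.ker S = T.eigenspace μ := by
    ext x
    rw [LinearMap.mem_ker, End.mem_eigenspace_iff, hS, LinearMap.sub_apply, sub_eq_zero, eq_comm]
    rfl
  have hχ : (Matrix.scalar n μ - a).det = 0 := by
    rw [← Matrix.eval_charpoly, ha, LinearMap.charpoly_toMatrix]
    exact ((finrank_eigenspace_eq_one_iff hT μ).1 hfin).1
  have hCS : C ∘ₗ S = 0 := by
    rw [hC, ← Matrix.toLin_toMatrix b b S, hSm, ← Matrix.toLin_mul, Matrix.adjugate_mul, hχ,
      zero_smul, map_zero]
  have hψψ : ⟪ψ, ψ⟫_ℂ ≠ 0 := inner_self_ne_zero.2 hψ0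
  have hCψ : C ψ = T.charpoly.derivative.eval μ • ψ := by
    apply b.repr.injective
    have hv : a.mulVec (b.repr ψ) = μ • ⇑(b.repr ψ) := by
      rw [ha, LinearMap.toMatrix_mulVec_repr, End.mem_eigenspace_iff.1 hψ, map_smul]
      rfl
    have h := Matrix.adjugate_scalar_sub_mulVec a μ (b.repr ψ) hv
      (fun h => hψ0 (b.repr.map_eq_zero_iff.1 (Finsupp.coe_eq_zero.1 h)))
    rw [ha, LinearMap.charpoly_toMatrix] at h
    apply DFunLike.coe_injective
    rw [← LinearMap.toMatrix_mulVec_repr b b C, hC, LinearMap.toMatrix_toLin, h, map_smul]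
    rfl
  have hCP : C = T.charpoly.derivative.eval μ • P := by
    apply LinearMap.ext
    intro η
    -- `η - P η` is orthogonal to the kernel of `S`, hence in its range, where `C` vanishes.
    have hmem : η - P η ∈ LinearMap.range S := by
      rw [← Submodule.orthogonal_orthogonal (LinearMap.range S), hSsymm.orthogonal_range, hker,
        Submodule.mem_orthogonal]
      intro u hu
      obtain ⟨c, hc⟩ := (finrank_eq_one_iff_of_nonzero' (⟨ψ, hψ⟩ : T.eigenspace μ)
        (by simpa using hψ0)).1 hfin ⟨u, hu⟩
      have hc' : c • ψ = u := congrArg Subtype.val hc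
      rw [← hc', inner_smul_left, inner_sub_right, hP, inner_smul_right, div_mul_cancel₀ _ hψψ,
        sub_self, mul_zero]
    obtain ⟨y, hy⟩ := hmem
    have h0 : C (η - P η) = 0 := by
      rw [← hy]
      exact LinearMap.congr_fun hCS y
    rw [map_sub, sub_eq_zero] at h0
    rw [h0, LinearMap.smul_apply, hP, map_smul, hCψ, smul_comm]
  rw [← map_smul, ← hCP, hC, LinearMap.toMatrix_toLin]

end Symmetric

/-! ### Smooth dependence of a simple root of the characteristic polynomial -/

section SmoothRoot

open Filter Topology

variable {E : Type*} [NormedAddCommGroup E] [NormedSpace ℝ E]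
  {n : Type*} [Fintype n] [DecidableEq n]

theorem contDiffAt_det {m : WithTop ℕ∞} {a : E → Matrix n n ℂ} {w₀ : E}
    (ha : ∀ i j, ContDiffAt ℝ m (fun w => a w i j) w₀) :
    ContDiffAt ℝ m (fun w => (a w).det) w₀ := by
  simp only [Matrix.det_apply']
  refine ContDiffAt.sum fun σ _ => contDiffAt_const.mul ?_
  exact contDiffAt_prod fun i _ => ha _ _

theorem contDiffAt_adjugate {m : WithTop ℕ∞} {a : E → Matrix n n ℂ} {w₀ : E}
    (ha : ∀ i j, ContDiffAt ℝ m (fun w => a w i j) w₀) (i j : n) :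
    ContDiffAt ℝ m (fun w => (a w).adjugate i j) w₀ := by
  simp only [Matrix.adjugate_apply]
  refine contDiffAt_det fun k l => ?_
  by_cases h : k = j
  · subst h
    simpa using contDiffAt_const
  · simpa [Matrix.updateRow_ne h] using ha k l

theorem contDiffAt_scalar_sub {m : WithTop ℕ∞} {a : E → Matrix n n ℂ} {τ : E → ℂ} {w₀ : E}
    (ha : ∀ i j, ContDiffAt ℝ m (fun w => a w i j) w₀) (hτ : ContDiffAt ℝ m τ w₀) (i j : n) :
    ContDiffAt ℝ m (fun w => (Matrix.scalar n (τ w) - a w) i j) w₀ := by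
  simp only [Matrix.sub_apply, Matrix.scalar_apply, Matrix.diagonal_apply]
  by_cases h : i = j
  · simpa [h] using hτ.sub (ha j j)
  · simpa [h] using (ha i j).neg

/-- A root of the characteristic polynomial is bounded by the sum of the norms of the entries. -/
theorem norm_le_of_charpoly_eval_eq_zero {a : Matrix n n ℂ} {t : ℂ} (h : a.charpoly.eval t = 0) :
    ‖t‖ ≤ ∑ i, ∑ j, ‖a i j‖ := by
  by_contra! hlt
  rw [Matrix.eval_charpoly] at h
  refine det_ne_zero_of_sum_row_lt_diag (fun k => ?_) h
  have h1 : ∑ j ∈ Finset.univ.erase k, ‖(Matrix.scalar n t - a) k j‖ =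
      ∑ j ∈ Finset.univ.erase k, ‖a k j‖ := by
    refine Finset.sum_congr rfl fun j hj => ?_
    simp [Matrix.scalar_apply, Matrix.diagonal_apply_ne' _ (Finset.ne_of_mem_erase hj)]
  have h2 : ‖t‖ - ‖a k k‖ ≤ ‖(Matrix.scalar n t - a) k k‖ := by
    simpa [Matrix.scalar_apply] using norm_sub_norm_le t (a k k)
  have h3 := Finset.sum_erase_add Finset.univ (fun j => ‖a k j‖) (Finset.mem_univ k)
  have h4 : ∑ j, ‖a k j‖ ≤ ∑ i, ∑ j, ‖a i j‖ :=
    Finset.single_le_sum (f := fun i => ∑ j, ‖a i j‖)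
      (fun i _ => Finset.sum_nonneg fun j _ => norm_nonneg _) (Finset.mem_univ k)
  rw [h1]
  linarith

theorem contDiffAt_charpoly_eval {m : WithTop ℕ∞} {a : E → Matrix n n ℂ} {w₀ : E}
    (ha : ∀ i j, ContDiffAt ℝ m (fun w => a w i j) w₀) (t₀ : ℂ) :
    ContDiffAt ℝ m (fun u : E × ℂ => (a u.1).charpoly.eval u.2) (w₀, t₀) := by
  simp only [Matrix.eval_charpoly]
  refine contDiffAt_det fun i j => contDiffAt_scalar_sub (a := fun u : E × ℂ => a u.1)
    (fun i j => ?_) contDiffAt_snd i j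
  exact (ha i j).comp (w₀, t₀) contDiffAt_fst

/-- The real Fréchet derivative of `(w, t) ↦ χ_w(t)` in the direction `(0, c)` is `c χ_w'(t)`. -/
theorem fderiv_charpoly_eval_comp_inr {a : E → Matrix n n ℂ} {u : E × ℂ}
    (h : DifferentiableAt ℝ (fun u : E × ℂ => (a u.1).charpoly.eval u.2) u) (c : ℂ) :
    fderiv ℝ (fun u : E × ℂ => (a u.1).charpoly.eval u.2) u (0, c) =
      c * (a u.1).charpoly.derivative.eval u.2 := by
  have hd := h.hasFDerivAt.comp u.2 (hasFDerivAt_prodMk_right (𝕜 := ℝ) u.1 u.2)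
  have hd2 := ((a u.1).charpoly.hasDerivAt u.2).hasFDerivAt.restrictScalars ℝ
  simpa using DFunLike.congr_fun (hd.unique hd2) c

/-- `χ_w'(t)` is smooth in `(w, t)`, being a partial derivative of the smooth function `χ_w(t)`. -/
theorem contDiffAt_charpoly_derivative_eval {a : E → Matrix n n ℂ} {w₀ : E}
    (ha : ∀ i j, ContDiffAt ℝ ∞ (fun w => a w i j) w₀) (t₀ : ℂ) :
    ContDiffAt ℝ ∞ (fun u : E × ℂ => (a u.1).charpoly.derivative.eval u.2) (w₀, t₀) := by
  have hcd := contDiffAt_charpoly_eval ha t₀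
  have h : ContDiffAt ℝ ∞ (fun u : E × ℂ =>
      fderiv ℝ (fun u : E × ℂ => (a u.1).charpoly.eval u.2) u (0, 1)) (w₀, t₀) :=
    (hcd.fderiv_right (by simp)).clm_apply contDiffAt_const
  refine h.congr_of_eventuallyEq ?_
  filter_upwards [(hcd.of_le (m := 1) (by simp)).eventually (by simp)] with u hu
  rw [fderiv_charpoly_eval_comp_inr (hu.differentiableAt one_ne_zero), one_mul]

/-- The implicit function theorem for a simple root of the characteristic polynomial. -/
theorem exists_contDiffAt_charpoly_root [CompleteSpace E] {a : E → Matrix n n ℂ} {w₀ : E}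
    (ha : ∀ i j, ContDiffAt ℝ ∞ (fun w => a w i j) w₀) {t₀ : ℂ}
    (h0 : (a w₀).charpoly.eval t₀ = 0) (h1 : (a w₀).charpoly.derivative.eval t₀ ≠ 0) :
    ∃ m : E → ℂ, ContDiffAt ℝ ∞ m w₀ ∧ m w₀ = t₀ ∧
      (∀ᶠ w in 𝓝 w₀, (a w).charpoly.eval (m w) = 0) ∧
      ∀ᶠ u : E × ℂ in 𝓝 (w₀, t₀), (a u.1).charpoly.eval u.2 = 0 → m u.1 = u.2 := by
  set f : E × ℂ → ℂ := fun u => (a u.1).charpoly.eval u.2 with hf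
  have hcd : ContDiffAt ℝ ∞ f (w₀, t₀) := contDiffAt_charpoly_eval ha t₀
  have hn : (∞ : WithTop ℕ∞) ≠ 0 := by simp
  have hinv : (fderiv ℝ f (w₀, t₀) ∘L .inr ℝ E ℂ).IsInvertible := by
    refine ⟨(ContinuousLinearEquiv.unitsEquivAut ℂ (Units.mk0 _ h1)).restrictScalars ℝ, ?_⟩
    apply ContinuousLinearMap.ext
    intro c
    exact (fderiv_charpoly_eval_comp_inr (hcd.differentiableAt hn) c).symm
  refine ⟨hcd.implicitFunction hn hinv, hcd.contDiffAt_implicitFunction hn hinv,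
    hcd.implicitFunction_apply_self hn hinv, ?_, ?_⟩
  · filter_upwards [hcd.eventually_apply_implicitFunction hn hinv] with w hw
    exact hw.trans h0
  · filter_upwards [hcd.eventually_apply_eq_iff_implicitFunction hn hinv] with u hu h
    exact hu.1 (h.trans h0.symm)

/-- If the largest root `τ` of the characteristic polynomials of a smooth family of matrices with
real spectrum is simple at `w₀`, then `τ` is smooth at `w₀`, and so is the derivative `χ'(τ)` of the
characteristic polynomial. -/
theorem contDiffAt_top_charpoly_root [CompleteSpace E] {a : E → Matrix n n ℂ} {w₀ : E}
    (ha : ∀ i j, ContDiffAt ℝ ∞ (fun w => a w i j) w₀) {τ : E → ℝ}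
    (hτ : ∀ᶠ w in 𝓝 w₀, (a w).charpoly.eval (τ w : ℂ) = 0)
    (hmax : ∀ᶠ w in 𝓝 w₀, ∀ t : ℂ, (a w).charpoly.eval t = 0 → t.im = 0 ∧ t.re ≤ τ w)
    (h1 : (a w₀).charpoly.derivative.eval (τ w₀ : ℂ) ≠ 0) :
    ContDiffAt ℝ ∞ (fun w => (τ w : ℂ)) w₀ ∧
      ContDiffAt ℝ ∞ (fun w => (a w).charpoly.derivative.eval (τ w : ℂ)) w₀ := by
  obtain ⟨m, hm, hm0, hroot, huniq⟩ := exists_contDiffAt_charpoly_root ha hτ.self_of_nhds h1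
  have hmc : ContinuousAt m w₀ := hm.continuousAt
  -- Roots beyond `τ w₀ + ε` are excluded by compactness, as the roots are bounded near `w₀`.
  have hupper (ε : ℝ) (hε : 0 < ε) : ∀ᶠ w in 𝓝 w₀, τ w < τ w₀ + ε := by
    set s : E → ℝ := fun w => ∑ i, ∑ j, ‖a w i j‖ with hs
    have hsc : ContinuousAt s w₀ :=
      tendsto_finsetSum _ fun i _ => tendsto_finsetSum _ fun j _ => (ha i j).continuousAt.norm
    have hK : ∀ᶠ w in 𝓝 w₀, ∀ t ∈ Set.Icc (τ w₀ + ε) (s w₀ + 1),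
        (a w).charpoly.eval (t : ℂ) ≠ 0 := by
      refine isCompact_Icc.eventually_forall_of_forall_eventually fun t ht => ?_
      have hc : ContinuousAt (fun u : E × ℝ => (a u.1).charpoly.eval (u.2 : ℂ)) (w₀, t) :=
        ContinuousAt.comp (x := (w₀, t)) (f := fun u : E × ℝ => (u.1, (u.2 : ℂ)))
          (contDiffAt_charpoly_eval ha (t : ℂ)).continuousAt (by fun_prop)
      refine hc.eventually_ne fun h => ?_
      have := (hmax.self_of_nhds _ h).2
      rw [Complex.ofReal_re] at this
      linarith [ht.1]
    filter_upwards [hK, hτ, hsc.eventually_lt_const (lt_add_one (s w₀))] with w hw hw' hsw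
    by_contra! hle
    refine hw _ ⟨hle, ?_⟩ hw'
    have := norm_le_of_charpoly_eval_eq_zero hw'
    rw [Complex.norm_real] at this
    exact (le_abs_self _).trans (this.trans hsw.le)
  have hτc : ContinuousAt τ w₀ := by
    rw [ContinuousAt, tendsto_order]
    refine ⟨fun r hr => ?_, fun r hr => ?_⟩
    -- The implicit root is real, hence at most the largest root.
    · have hre : ContinuousAt (fun w => (m w).re) w₀ := Complex.continuous_re.continuousAt.comp hmc
      have : r < (m w₀).re := by rw [hm0, Complex.ofReal_re]; exact hr
      filter_upwards [hre.eventually_const_lt this, hroot, hmax] with w h2 h3 h4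
      exact h2.trans_le (h4 _ h3).2
    · filter_upwards [hupper (r - τ w₀) (sub_pos.2 hr)] with w hw
      linarith
  have hτc' : ContinuousAt (fun w => (τ w : ℂ)) w₀ :=
    Complex.continuous_ofReal.continuousAt.comp hτc
  have hpair : Tendsto (fun w => (w, (τ w : ℂ))) (𝓝 w₀) (𝓝 (w₀, (τ w₀ : ℂ))) :=
    (continuousAt_id.prodMk hτc').tendsto
  have heq : ∀ᶠ w in 𝓝 w₀, (τ w : ℂ) = m w := by
    filter_upwards [hpair.eventually huniq, hτ] with w h2 h3
    exact (h2 h3).symm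
  refine ⟨hm.congr_of_eventuallyEq heq, ?_⟩
  exact (contDiffAt_charpoly_derivative_eval ha _).comp w₀
    (contDiffAt_id.prodMk (hm.congr_of_eventuallyEq heq))

end SmoothRoot

/-! ### Bases and inner products on spaces of alternating forms -/

section Forms

variable {d p : ℕ} {V : Type*} [AddCommGroup V] [Module ℂ V]

theorem multiMinor_one (K L : MultiIndex d p) :
    multiMinor (1 : Matrix (Fin d) (Fin d) ℂ) K L = if K = L then 1 else 0 := by
  have h : multiMinor (1 : Matrix (Fin d) (Fin d) ℂ) K L =
      exteriorPower.ιMultiDual ℂ p (Pi.basisFun ℂ (Fin d)) K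
        (exteriorPower.ιMulti_family ℂ p (Pi.basisFun ℂ (Fin d)) L) := by
    rw [exteriorPower.ιMulti_family, exteriorPower.ιMultiDual_apply_ιMulti, multiMinor,
      ← Matrix.det_transpose]
    congr 1
    ext i j
    simp [Matrix.one_apply, Pi.single_apply]
    rfl
  rw [h]
  split_ifs with hKL
  · rw [hKL, exteriorPower.ιMultiDual_apply_diag]
  · exact exteriorPower.ιMultiDual_apply_nondiag ℂ p _ K L hKL

/-- The form `e^K = e^{k₁} ∧ ⋯ ∧ e^{k_p}`, where `e^i` are the coordinates of the basis `b`. -/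
def wedgeCoord (b : Basis (Fin d) ℂ V) (K : MultiIndex d p) : V [⋀^Fin p]→ₗ[ℂ] ℂ :=
  (Matrix.detRowAlternating (R := ℂ) (n := Fin p)).compLinearMap
    (LinearMap.pi fun i => b.coord (K.entry i))

theorem wedgeCoord_apply (b : Basis (Fin d) ℂ V) (K : MultiIndex d p) (v : Fin p → V) :
    wedgeCoord b K v = (Matrix.of fun i j : Fin p => b.repr (v j) (K.entry i)).det := by
  rw [← Matrix.det_transpose]
  rfl

theorem wedgeCoord_apply_basis (b : Basis (Fin d) ℂ V) (K L : MultiIndex d p) :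
    wedgeCoord b K (fun i => b (L.entry i)) = if K = L then 1 else 0 := by
  rw [wedgeCoord_apply, ← multiMinor_one, multiMinor]
  congr 1
  ext i j
  simp [Matrix.one_apply, Finsupp.single_apply, eq_comm]

theorem sum_smul_alternating_apply {ι : Type*} (s : Finset ι) (c : ι → ℂ)
    (e : ι → V [⋀^Fin p]→ₗ[ℂ] ℂ) (v : Fin p → V) :
    (∑ K ∈ s, c K • e K) v = ∑ K ∈ s, c K * e K v := by
  induction s using Finset.cons_induction with
  | empty => rfl
  | cons K s hK ih => rw [Finset.sum_cons, Finset.sum_cons, AlternatingMap.add_apply, ih]; rfl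

/-- The basis `e^K` of the space of alternating `p`-forms dual to a basis of `V`; the coefficient
of `η` at `e^K` is the value of `η` at `(b_{k₁}, …, b_{k_p})`. -/
def formBasis (b : Basis (Fin d) ℂ V) : Basis (MultiIndex d p) ℂ (V [⋀^Fin p]→ₗ[ℂ] ℂ) :=
  Basis.ofEquivFun
    { toFun := fun η K => η fun i => b (K.entry i)
      map_add' := fun _ _ => rfl
      map_smul' := fun _ _ => rfl
      invFun := fun c => ∑ K, c K • wedgeCoord b K
      left_inv := fun η => by
        ext v
        rw [alternating_expand b η v]
        simp [sum_smul_alternating_apply, wedgeCoord_apply]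
      right_inv := fun c => by
        ext K
        simp [sum_smul_alternating_apply, wedgeCoord_apply_basis] }

theorem formBasis_repr (b : Basis (Fin d) ℂ V) (η : V [⋀^Fin p]→ₗ[ℂ] ℂ) (K : MultiIndex d p) :
    (formBasis b).repr η K = η fun i => b (K.entry i) := rfl

theorem formBasis_apply (b : Basis (Fin d) ℂ V) (K : MultiIndex d p) :
    formBasis b K = wedgeCoord b K := by
  apply (formBasis b).repr.injective
  ext L
  rw [Basis.repr_self, formBasis_repr, wedgeCoord_apply_basis, Finsupp.single_apply]

/-- A Hermitian inner product has an orthonormal basis. -/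
theorem exists_basis_gramOf_eq_one (h : V →ₗ[ℂ] V →ₗ⋆[ℂ] ℂ)
    (hsymm : ∀ u v, conj (h u v) = h v u) (hpos : ∀ u, u ≠ 0 → 0 < (h u u).re)
    (b : Basis (Fin d) ℂ V) : ∃ b' : Basis (Fin d) ℂ V, gramOf h b' = 1 := by
  let core : InnerProductSpace.Core ℂ V :=
    { inner := fun u v => h v u
      conj_inner_symm := fun u v => hsymm u v
      re_inner_nonneg := fun u => by
        by_cases hu : u = 0
        · simp [hu]
        · exact (hpos u hu).le
      add_left := fun u v w => by simp
      smul_left := fun u v r => by simp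
      definite := fun u hu => by
        by_contra h0
        have := hpos u h0
        rw [hu] at this
        simp at this }
  let : NormedAddCommGroup V := core.toNormedAddCommGroup
  let : InnerProductSpace ℂ V := InnerProductSpace.ofCore core.toCore
  have : FiniteDimensional ℂ V := b.finiteDimensional_of_finite
  have hd : finrank ℂ V = d := by rw [finrank_eq_card_basis b, Fintype.card_fin]
  let o : OrthonormalBasis (Fin d) ℂ V := (stdOrthonormalBasis ℂ V).reindex (finCongr hd)
  refine ⟨o.toBasis, ?_⟩
  ext i j
  have := orthonormal_iff_ite.1 o.orthonormal j i
  rw [gramOf, Matrix.of_apply, Matrix.one_apply]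
  simp only [eq_comm (a := i), OrthonormalBasis.coe_toBasis]
  exact this

theorem formPairing_of_gramOf_eq_one {h : V →ₗ[ℂ] V →ₗ⋆[ℂ] ℂ} {b : Fin d → V}
    (hb : gramOf h b = 1) (η τ : V [⋀^Fin p]→ₗ[ℂ] ℂ) :
    formPairing h b η τ = ∑ K : MultiIndex d p,
      η (fun i => b (K.entry i)) * conj (τ fun i => b (K.entry i)) := by
  simp [formPairing, dualMatrix, hb, multiMinor_one]

theorem rankOneProj_apply (h : V →ₗ[ℂ] V →ₗ⋆[ℂ] ℂ) (b : Fin d → V)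
    (ψ η : V [⋀^Fin p]→ₗ[ℂ] ℂ) :
    rankOneProj h b ψ η = (formPairing h b η ψ / formPairing h b ψ ψ) • ψ := rfl

theorem isIdempotentElem_rankOneProj {h : V →ₗ[ℂ] V →ₗ⋆[ℂ] ℂ} {b : Fin d → V}
    {ψ : V [⋀^Fin p]→ₗ[ℂ] ℂ} (hψ : formPairing h b ψ ψ ≠ 0) :
    IsIdempotentElem (rankOneProj h b ψ) := by
  apply LinearMap.ext
  intro η
  rw [Module.End.mul_apply, rankOneProj_apply h b ψ η, map_smul, rankOneProj_apply h b ψ ψ,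
    div_self hψ, one_smul]

/-- The form induced on alternating `p`-forms by a Hermitian inner product `h` on `V` is an inner
product; Mathlib's convention of conjugate-linearity in the first variable swaps the arguments. -/
abbrev formCore (h : V →ₗ[ℂ] V →ₗ⋆[ℂ] ℂ)
    (hsymm : ∀ u v, conj (h u v) = h v u) (hpos : ∀ u, u ≠ 0 → 0 < (h u u).re)
    (b : Basis (Fin d) ℂ V) : InnerProductSpace.Core ℂ (V [⋀^Fin p]→ₗ[ℂ] ℂ) where
  inner η τ := formPairing h b τ η
  conj_inner_symm η τ := by
    obtain ⟨b', hb'⟩ := exists_basis_gramOf_eq_one h hsymm hpos b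
    simp only [formPairing_basis_independent h b b', formPairing_of_gramOf_eq_one hb', map_sum,
      map_mul, Complex.conj_conj, mul_comm]
  re_inner_nonneg η := by
    obtain ⟨b', hb'⟩ := exists_basis_gramOf_eq_one h hsymm hpos b
    simp only [formPairing_basis_independent h b b', formPairing_of_gramOf_eq_one hb',
      Complex.mul_conj]
    rw [map_sum]
    exact Finset.sum_nonneg fun K _ => Complex.normSq_nonneg _
  add_left η τ σ := by
    simp only [formPairing, AlternatingMap.add_apply, map_add, mul_add, add_mul,
      Finset.sum_add_distrib]
  smul_left η τ r := by
    simp only [formPairing, AlternatingMap.smul_apply, smul_eq_mul, map_mul, Finset.mul_sum]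
    refine Finset.sum_congr rfl fun K _ => Finset.sum_congr rfl fun L _ => ?_
    ring
  definite η h0 := by
    obtain ⟨b', hb'⟩ := exists_basis_gramOf_eq_one h hsymm hpos b
    simp only [formPairing_basis_independent h b b', formPairing_of_gramOf_eq_one hb',
      Complex.mul_conj] at h0
    rw [← Complex.ofReal_sum, Complex.ofReal_eq_zero,
      Finset.sum_eq_zero_iff_of_nonneg fun K _ => Complex.normSq_nonneg _] at h0
    apply (formBasis b').repr.injective
    ext K
    rw [formBasis_repr, Complex.normSq_eq_zero.1 (h0 K (Finset.mem_univ K)), map_zero]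
    rfl

end Forms

/-! ### Coordinate frames of a holomorphic chart -/

section Charts

variable {d p : ℕ} {M : Type*} [TopologicalSpace M] [ChartedSpace (ModelSpace d) M]

theorem IsHolChart.mdifferentiable {φ : OpenPartialHomeomorph M (ModelSpace d)}
    (hφ : IsHolChart φ) : φ.MDifferentiable 𝓘(ℂ, ModelSpace d) 𝓘(ℂ, ModelSpace d) := by
  have h1 : φ ∈ IsManifold.maximalAtlas 𝓘(ℂ, ModelSpace d) 1 M :=
    IsManifold.maximalAtlas_subset_of_le (by simp) hφ
  exact ⟨fun x hx => (mdifferentiableAt_of_mem_maximalAtlas h1 hx).mdifferentiableWithinAt,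
    fun x hx => (mdifferentiableAt_symm_of_mem_maximalAtlas h1 hx).mdifferentiableWithinAt⟩

theorem coordCovector_coordVector {φ : OpenPartialHomeomorph M (ModelSpace d)}
    (hφ : IsHolChart φ) {w : ModelSpace d} (hw : w ∈ φ.target) (i j : Fin d) :
    coordCovector φ i (φ.symm w) (coordVector φ j w) = if i = j then 1 else 0 := by
  have h := DFunLike.congr_fun (hφ.mdifferentiable.comp_symm_deriv hw)
    (EuclideanSpace.single j (1 : ℂ))
  have h2 := congrArg (EuclideanSpace.proj (𝕜 := ℂ) i) h
  refine h2.trans ?_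
  change (EuclideanSpace.single j (1 : ℂ)) i = _
  rw [PiLp.single_apply]

/-- The coordinate frame `∂_i` as a basis of `T^{1,0}`. -/
def coordBasis {φ : OpenPartialHomeomorph M (ModelSpace d)} (hφ : IsHolChart φ)
    {w : ModelSpace d} (hw : w ∈ φ.target) : Basis (Fin d) ℂ (HolTangent d (φ.symm w)) :=
  have : FiniteDimensional ℂ (HolTangent d (φ.symm w)) :=
    (tangentBasis (φ.symm w)).finiteDimensional_of_finite
  basisOfLinearIndependentOfCardEqFinrank' (fun i => coordVector φ i w)
    (LinearIndependent.of_pairwise_dual_eq_zero_one _ (fun i => coordCovector φ i (φ.symm w))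
      (fun i j hij => (coordCovector_coordVector hφ hw i j).trans (if_neg hij))
      (fun i => (coordCovector_coordVector hφ hw i i).trans (if_pos rfl)))
    (finrank_eq_card_basis (tangentBasis (φ.symm w))).symm

theorem coordBasis_apply {φ : OpenPartialHomeomorph M (ModelSpace d)} (hφ : IsHolChart φ)
    {w : ModelSpace d} (hw : w ∈ φ.target) (i : Fin d) :
    coordBasis hφ hw i = coordVector φ i w := by
  simp [coordBasis]

theorem coordBasis_coord {φ : OpenPartialHomeomorph M (ModelSpace d)} (hφ : IsHolChart φ)
    {w : ModelSpace d} (hw : w ∈ φ.target) (i : Fin d) :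
    (coordBasis hφ hw).coord i = coordCovector φ i (φ.symm w) := by
  refine (coordBasis hφ hw).ext fun j => ?_
  rw [Basis.coord_apply, Basis.repr_self, coordBasis_apply, coordCovector_coordVector hφ hw,
    Finsupp.single_apply]
  simp only [eq_comm]

/-- The basis `dz^K` of the fibre of `Λ^{p,0}`. -/
def coordFormBasis (p : ℕ) {φ : OpenPartialHomeomorph M (ModelSpace d)} (hφ : IsHolChart φ)
    {w : ModelSpace d} (hw : w ∈ φ.target) :
    Basis (MultiIndex d p) ℂ (HolForm d p (φ.symm w)) :=
  formBasis (coordBasis hφ hw)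

theorem coordFormBasis_apply {φ : OpenPartialHomeomorph M (ModelSpace d)} (hφ : IsHolChart φ)
    {w : ModelSpace d} (hw : w ∈ φ.target) (K : MultiIndex d p) :
    coordFormBasis p hφ hw K = coordForm φ K (φ.symm w) := by
  rw [coordFormBasis, formBasis_apply, wedgeCoord, coordForm]
  simp only [coordBasis_coord]

/-- In coordinates the coefficients `b_K^L` are the entries of the matrix of the endomorphism. -/
theorem toMatrix_coordFormBasis {φ : OpenPartialHomeomorph M (ModelSpace d)} (hφ : IsHolChart φ)
    {w : ModelSpace d} (hw : w ∈ φ.target) (B : ∀ x : M, End ℂ (HolForm d p x))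
    (K L : MultiIndex d p) :
    LinearMap.toMatrix (coordFormBasis p hφ hw) (coordFormBasis p hφ hw) (B (φ.symm w)) K L =
      endCoeff φ B K L w := by
  rw [LinearMap.toMatrix_apply, coordFormBasis_apply, coordFormBasis, formBasis_repr, endCoeff]
  simp only [coordBasis_apply]

end Charts

/-! ### The top eigenline of a fibrewise self-adjoint endomorphism -/

section TopEigenline

open Filter Topology

variable {d p : ℕ} {M : Type*} [TopologicalSpace M] [ChartedSpace (ModelSpace d) M]

namespace HermitianMetric

variable (g : HermitianMetric d M)

/-- The inner product on `Λ^{p,0}_x` induced by the metric. -/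
abbrev formInnerCore (p : ℕ) (x : M) : InnerProductSpace.Core ℂ (HolForm d p x) :=
  formCore (g.inner x) (g.conj_symm x) (g.pos x) (tangentBasis x)

theorem formInner_self_ne_zero {x : M} {ψ : HolForm d p x} (hψ : ψ ≠ 0) :
    g.formInner x ψ ψ ≠ 0 :=
  fun h => hψ ((g.formInnerCore p x).definite ψ h)

instance finiteDimensional_holForm (x : M) : FiniteDimensional ℂ (HolForm d p x) :=
  (formBasis (tangentBasis x)).finiteDimensional_of_finite

theorem finrank_eigenspace_eq_one_iff_of_selfAdjoint {x : M} {T : End ℂ (HolForm d p x)}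
    (hT : ∀ η τ, g.formInner x (T η) τ = g.formInner x η (T τ)) (μ : ℂ) :
    finrank ℂ (T.eigenspace μ) = 1 ↔
      T.charpoly.eval μ = 0 ∧ T.charpoly.derivative.eval μ ≠ 0 := by
  let : NormedAddCommGroup (HolForm d p x) := (g.formInnerCore p x).toNormedAddCommGroup
  let : InnerProductSpace ℂ (HolForm d p x) := InnerProductSpace.ofCore (g.formInnerCore p x).toCore
  exact finrank_eigenspace_eq_one_iff (fun η τ => (hT τ η).symm) μ

/-- The top eigenvalue is an eigenvalue; the multi-index `K` witnesses that `Λ^{p,0}_x ≠ 0`. -/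
theorem charpoly_eval_topEigenvalue {x : M} {T : End ℂ (HolForm d p x)}
    (hT : ∀ η τ, g.formInner x (T η) τ = g.formInner x η (T τ)) (K : MultiIndex d p) :
    T.charpoly.eval (topEigenvalue T : ℂ) = 0 := by
  let : NormedAddCommGroup (HolForm d p x) := (g.formInnerCore p x).toNormedAddCommGroup
  let : InnerProductSpace ℂ (HolForm d p x) := InnerProductSpace.ofCore (g.formInnerCore p x).toCore
  have : Nontrivial (HolForm d p x) :=
    ⟨⟨formBasis (tangentBasis x) K, 0, (formBasis (tangentBasis x)).ne_zero K⟩⟩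
  exact (End.hasEigenvalue_iff_isRoot_charpoly T _).1
    (hasEigenvalue_topEigenvalue (fun η τ => (hT τ η).symm))

theorem charpoly_root_real_le {x : M} {T : End ℂ (HolForm d p x)}
    (hT : ∀ η τ, g.formInner x (T η) τ = g.formInner x η (T τ)) {μ : ℂ}
    (hμ : T.charpoly.eval μ = 0) : μ.im = 0 ∧ μ.re ≤ topEigenvalue T := by
  let : NormedAddCommGroup (HolForm d p x) := (g.formInnerCore p x).toNormedAddCommGroup
  let : InnerProductSpace ℂ (HolForm d p x) := InnerProductSpace.ofCore (g.formInnerCore p x).toCore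
  have hs : LinearMap.IsSymmetric T := fun η τ => (hT τ η).symm
  exact ⟨im_eq_zero_of_charpoly_eval_eq_zero hs hμ,
    re_le_topEigenvalue hs ((End.hasEigenvalue_iff_isRoot_charpoly T μ).2 hμ)⟩

/-- The projection `|ψ|⁻² ψ ⊗ ψ^*` onto a simple top eigenline is, up to the factor `χ'(τ)`, the
adjugate of `τ - T`, where `τ` is the top eigenvalue. -/
theorem adjugate_scalar_sub_toMatrix_lineProj {x : M} {T : End ℂ (HolForm d p x)}
    (hT : ∀ η τ, g.formInner x (T η) τ = g.formInner x η (T τ))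
    (hfin : finrank ℂ (topEigenspace T) = 1)
    {n : Type*} [Fintype n] [DecidableEq n] (b : Basis n ℂ (HolForm d p x)) :
    (Matrix.scalar n (topEigenvalue T : ℂ) - LinearMap.toMatrix b b T).adjugate =
      T.charpoly.derivative.eval (topEigenvalue T : ℂ) •
        LinearMap.toMatrix b b (lineProj (g.inner x) (tangentBasis x) (topEigenspace T)) := by
  let : NormedAddCommGroup (HolForm d p x) := (g.formInnerCore p x).toNormedAddCommGroup
  let : InnerProductSpace ℂ (HolForm d p x) := InnerProductSpace.ofCore (g.formInnerCore p x).toCore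
  obtain ⟨⟨ψ, hψ⟩, hψ0, -⟩ := finrank_eq_one_iff'.1 hfin
  have hψ0' : ψ ≠ 0 := fun h => hψ0 (Subtype.ext h)
  rw [lineProj_eq _ _ _ hfin ψ hψ hψ0']
  exact adjugate_scalar_sub_toMatrix (fun η τ => (hT τ η).symm) (Complex.ofReal_im _) hfin hψ hψ0'
    (fun η => rfl) b

theorem isIdempotentElem_lineProj {x : M} {F : Submodule ℂ (HolForm d p x)}
    (hfin : finrank ℂ F = 1) :
    IsIdempotentElem (lineProj (g.inner x) (tangentBasis x) F) := by
  obtain ⟨⟨ψ, hψ⟩, hψ0, -⟩ := finrank_eq_one_iff'.1 hfin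
  have hψ0' : ψ ≠ 0 := fun h => hψ0 (Subtype.ext h)
  rw [lineProj_eq _ _ _ hfin ψ hψ hψ0']
  exact isIdempotentElem_rankOneProj (g.formInner_self_ne_zero hψ0')

end HermitianMetric

/-- The coefficients of a family of endomorphisms as a matrix-valued function of the
coordinates. -/
def endMatrix (φ : OpenPartialHomeomorph M (ModelSpace d)) (B : ∀ x : M, End ℂ (HolForm d p x))
    (w : ModelSpace d) : Matrix (MultiIndex d p) (MultiIndex d p) ℂ :=
  Matrix.of fun K L => endCoeff φ B K L w

theorem endMatrix_eq_toMatrix {φ : OpenPartialHomeomorph M (ModelSpace d)} (hφ : IsHolChart φ)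
    {w : ModelSpace d} (hw : w ∈ φ.target) (B : ∀ x : M, End ℂ (HolForm d p x)) :
    endMatrix φ B w =
      LinearMap.toMatrix (coordFormBasis p hφ hw) (coordFormBasis p hφ hw) (B (φ.symm w)) := by
  ext K L
  rw [toMatrix_coordFormBasis, endMatrix, Matrix.of_apply]

theorem charpoly_endMatrix {φ : OpenPartialHomeomorph M (ModelSpace d)} (hφ : IsHolChart φ)
    {w : ModelSpace d} (hw : w ∈ φ.target) (B : ∀ x : M, End ℂ (HolForm d p x)) :
    (endMatrix φ B w).charpoly = (B (φ.symm w)).charpoly := by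
  rw [endMatrix_eq_toMatrix hφ hw, LinearMap.charpoly_toMatrix]

theorem SmoothEndOn.contDiffAt {B : ∀ x : M, End ℂ (HolForm d p x)}
    (hB : SmoothEndOn B Set.univ) {φ : OpenPartialHomeomorph M (ModelSpace d)}
    (hφ : IsHolChart φ) {w : ModelSpace d} (hw : w ∈ φ.target) (K L : MultiIndex d p) :
    ContDiffAt ℝ ∞ (endCoeff φ B K L) w := by
  have h := hB φ hφ K L
  rw [Set.preimage_univ, Set.inter_univ] at h
  exact h.contDiffAt (φ.open_target.mem_nhds hw)

variable (g : HermitianMetric d M) {A : ∀ x : M, End ℂ (HolForm d p x)}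

/-- Near a point where the top eigenvalue is simple it stays simple, and both it and the projection
onto its eigenline are smooth. -/
theorem contDiffAt_charSection_topEigenspace (hA : SmoothEndOn A Set.univ)
    (hsa : g.IsFibrewiseSelfAdjoint A) {φ : OpenPartialHomeomorph M (ModelSpace d)}
    (hφ : IsHolChart φ) {w₀ : ModelSpace d} (hw₀ : w₀ ∈ φ.target)
    (hsimple : finrank ℂ (topEigenspace (A (φ.symm w₀))) = 1) (I : MultiIndex d p) :
    (∀ᶠ w in 𝓝 w₀, finrank ℂ (topEigenspace (A (φ.symm w))) = 1) ∧
      ContDiffAt ℝ ∞ (fun w => (topEigenvalue (A (φ.symm w)) : ℂ)) w₀ ∧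
      ∀ K L : MultiIndex d p, ContDiffAt ℝ ∞
        (endCoeff φ (g.charSection fun x => topEigenspace (A x)) K L) w₀ := by
  have htgt : ∀ᶠ w in 𝓝 w₀, w ∈ φ.target := φ.open_target.mem_nhds hw₀
  have ha (K L : MultiIndex d p) : ContDiffAt ℝ ∞ (fun w => endMatrix φ A w K L) w₀ :=
    hA.contDiffAt hφ hw₀ K L
  set τ : ModelSpace d → ℝ := fun w => topEigenvalue (A (φ.symm w)) with hτ
  have hder : (endMatrix φ A w₀).charpoly.derivative.eval (τ w₀ : ℂ) ≠ 0 := by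
    rw [charpoly_endMatrix hφ hw₀]
    exact ((g.finrank_eigenspace_eq_one_iff_of_selfAdjoint (hsa _) _).1 hsimple).2
  have hroot : ∀ᶠ w in 𝓝 w₀, (endMatrix φ A w).charpoly.eval (τ w : ℂ) = 0 := by
    filter_upwards [htgt] with w hw
    rw [charpoly_endMatrix hφ hw]
    exact g.charpoly_eval_topEigenvalue (hsa _) I
  have hmax : ∀ᶠ w in 𝓝 w₀, ∀ t : ℂ, (endMatrix φ A w).charpoly.eval t = 0 →
      t.im = 0 ∧ t.re ≤ τ w := by
    filter_upwards [htgt] with w hw t ht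
    rw [charpoly_endMatrix hφ hw] at ht
    exact g.charpoly_root_real_le (hsa _) ht
  obtain ⟨hτs, hτd⟩ := contDiffAt_top_charpoly_root ha hroot hmax hder
  have hne : ∀ᶠ w in 𝓝 w₀, (endMatrix φ A w).charpoly.derivative.eval (τ w : ℂ) ≠ 0 :=
    hτd.continuousAt.eventually_ne hder
  have hone : ∀ᶠ w in 𝓝 w₀, finrank ℂ (topEigenspace (A (φ.symm w))) = 1 := by
    filter_upwards [htgt, hroot, hne] with w hw h1 h2
    rw [charpoly_endMatrix hφ hw] at h1 h2
    exact (g.finrank_eigenspace_eq_one_iff_of_selfAdjoint (hsa _) _).2 ⟨h1, h2⟩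
  refine ⟨hone, hτs, fun K L => ?_⟩
  have hadj (K L : MultiIndex d p) : ContDiffAt ℝ ∞ (fun w =>
      (Matrix.scalar (MultiIndex d p) (τ w : ℂ) - endMatrix φ A w).adjugate K L) w₀ :=
    contDiffAt_adjugate (fun i j => contDiffAt_scalar_sub ha hτs i j) K L
  refine ((hτd.inv hder).mul (hadj K L)).congr_of_eventuallyEq ?_
  filter_upwards [htgt, hone, hne] with w hw h1 h2
  rw [Pi.inv_apply, eq_inv_mul_iff_mul_eq₀ h2, charpoly_endMatrix hφ hw, endMatrix_eq_toMatrix hφ hw,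
    g.adjugate_scalar_sub_toMatrix_lineProj (hsa _) h1, Matrix.smul_apply, smul_eq_mul]
  congr 1
  exact (toMatrix_coordFormBasis hφ hw (g.charSection fun x => topEigenspace (A x)) K L).symm

end TopEigenline

/-! ### The Wirtinger derivative of a spectral projection -/

section Dbar

open Filter Topology

variable {d : ℕ} {w₀ : ModelSpace d}

theorem dbar_mul (j : Fin d) {f g : ModelSpace d → ℂ} (hf : DifferentiableAt ℝ f w₀)
    (hg : DifferentiableAt ℝ g w₀) :
    dbar j (fun w => f w * g w) w₀ = dbar j f w₀ * g w₀ + f w₀ * dbar j g w₀ := by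
  simp only [dbar, fderiv_fun_mul hf hg, add_apply,
    smul_apply, smul_eq_mul]
  ring

theorem dbar_sum (j : Fin d) {ι : Type*} (s : Finset ι) {f : ι → ModelSpace d → ℂ}
    (hf : ∀ i ∈ s, DifferentiableAt ℝ (f i) w₀) :
    dbar j (fun w => ∑ i ∈ s, f i w) w₀ = ∑ i ∈ s, dbar j (f i) w₀ := by
  simp only [dbar, fderiv_fun_sum hf, sum_apply, Finset.mul_sum,
    ← Finset.sum_add_distrib]

theorem Filter.EventuallyEq.dbar_eq (j : Fin d) {f g : ModelSpace d → ℂ} (h : f =ᶠ[𝓝 w₀] g) :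
    dbar j f w₀ = dbar j g w₀ := by
  rw [dbar, dbar, h.fderiv_eq]

/-- The Wirtinger derivative of a matrix-valued function, entry by entry. -/
def dbarMatrix {n : Type*} (j : Fin d) (a : ModelSpace d → Matrix n n ℂ) (w : ModelSpace d) :
    Matrix n n ℂ :=
  Matrix.of fun K L => dbar j (fun w => a w K L) w

variable {n : Type*} {a b P : ModelSpace d → Matrix n n ℂ}

theorem dbarMatrix_smul (j : Fin d) {τ : ModelSpace d → ℂ} (hτ : DifferentiableAt ℝ τ w₀)
    (hb : ∀ K L, DifferentiableAt ℝ (fun w => b w K L) w₀) :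
    dbarMatrix j (fun w => τ w • b w) w₀ = dbar j τ w₀ • b w₀ + τ w₀ • dbarMatrix j b w₀ := by
  ext K L
  exact dbar_mul j hτ (hb K L)

theorem dbarMatrix_congr (j : Fin d) (h : a =ᶠ[𝓝 w₀] b) :
    dbarMatrix j a w₀ = dbarMatrix j b w₀ := by
  ext K L
  exact Filter.EventuallyEq.dbar_eq j (h.mono fun w hw => congrFun (congrFun hw K) L)

variable [Fintype n]

theorem dbarMatrix_mul (j : Fin d) (ha : ∀ K L, DifferentiableAt ℝ (fun w => a w K L) w₀)
    (hb : ∀ K L, DifferentiableAt ℝ (fun w => b w K L) w₀) :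
    dbarMatrix j (fun w => a w * b w) w₀ = dbarMatrix j a w₀ * b w₀ + a w₀ * dbarMatrix j b w₀ := by
  ext K L
  simp only [dbarMatrix, Matrix.of_apply, Matrix.add_apply, Matrix.mul_apply]
  rw [dbar_sum j Finset.univ fun N _ => (ha K N).fun_mul (hb N L), ← Finset.sum_add_distrib]
  exact Finset.sum_congr rfl fun N _ => dbar_mul j (ha K N) (hb N L)

variable [DecidableEq n] {τ : ModelSpace d → ℂ}

/-- First-order perturbation of a spectral projection: differentiating `a P = τ P` and `P a = τ P`
at a point where `a` is diagonal and `P` projects onto the axis `I` determines the row and the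
column of `∂̄P` through `I` off the diagonal, and `P² = P` makes all other entries vanish. -/
theorem dbarMatrix_projection (j : Fin d)
    (ha : ∀ K L, DifferentiableAt ℝ (fun w => a w K L) w₀)
    (hP : ∀ K L, DifferentiableAt ℝ (fun w => P w K L) w₀) (hτ : DifferentiableAt ℝ τ w₀)
    (hl : ∀ᶠ w in 𝓝 w₀, a w * P w = τ w • P w) (hr : ∀ᶠ w in 𝓝 w₀, P w * a w = τ w • P w)
    (hidem : ∀ᶠ w in 𝓝 w₀, P w * P w = P w) {lam : n → ℂ} {I : n}
    (ha₀ : a w₀ = Matrix.diagonal lam) (hP₀ : P w₀ = Matrix.single I I 1) (hτ₀ : τ w₀ = lam I)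
    (hlam : ∀ J, J ≠ I → lam I - lam J ≠ 0) :
    (∀ J, J ≠ I → dbarMatrix j P w₀ J I = (lam I - lam J)⁻¹ * dbarMatrix j a w₀ J I) ∧
    (∀ J, J ≠ I → dbarMatrix j P w₀ I J = (lam I - lam J)⁻¹ * dbarMatrix j a w₀ I J) ∧
    (∀ K L, K ≠ I → L ≠ I → dbarMatrix j P w₀ K L = 0) ∧ dbarMatrix j P w₀ I I = 0 := by
  have h1 := dbarMatrix_congr j hl
  have h2 := dbarMatrix_congr j hr
  have h3 := dbarMatrix_congr j hidem
  rw [dbarMatrix_mul j ha hP, dbarMatrix_smul j hτ hP, ha₀, hP₀, hτ₀] at h1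
  rw [dbarMatrix_mul j hP ha, dbarMatrix_smul j hτ hP, ha₀, hP₀, hτ₀] at h2
  rw [dbarMatrix_mul j hP hP, hP₀] at h3
  refine ⟨fun J hJ => ?_, fun J hJ => ?_, fun K L hK hL => ?_, ?_⟩
  · have h := congrFun (congrFun h1 J) I
    simp [Matrix.add_apply, Matrix.diagonal_mul, Matrix.single_apply_of_row_ne hJ.symm] at h
    rw [eq_inv_mul_iff_mul_eq₀ (hlam J hJ), sub_mul, ← h, add_sub_cancel_right]
  · have h := congrFun (congrFun h2 I) J
    simp [Matrix.add_apply, Matrix.mul_diagonal, Matrix.single_apply_of_col_ne _ _ hJ.symm] at h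
    rw [eq_inv_mul_iff_mul_eq₀ (hlam J hJ), sub_mul, ← h]
    ring
  · have h := congrFun (congrFun h3 K) L
    simpa [Matrix.add_apply, hK, hL, eq_comm] using h
  · have h := congrFun (congrFun h3 I) I
    simpa [Matrix.add_apply] using h

end Dbar

section Norms

variable {d p : ℕ} {M : Type*} [TopologicalSpace M] [ChartedSpace (ModelSpace d) M]
  (g : HermitianMetric d M) {φ : OpenPartialHomeomorph M (ModelSpace d)} {w : ModelSpace d}

theorem normSqDbar_of_coordMatrix_eq_one (hg : g.coordMatrix φ w = 1) (f : ModelSpace d → ℂ) :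
    g.normSqDbar φ f w = ∑ j, Complex.normSq (dbar j f w) := by
  simp only [HermitianMetric.normSqDbar, hg, dualMatrix, inv_one, Matrix.transpose_one,
    Matrix.one_apply, ite_mul, one_mul, zero_mul, Finset.sum_ite_eq', Finset.mem_univ, if_true,
    Complex.mul_conj, Complex.re_sum, Complex.ofReal_re]

theorem normSqDbarEnd_of_coordMatrix_eq_one (hg : g.coordMatrix φ w = 1)
    (B : ∀ x : M, End ℂ (HolForm d p x)) :
    g.normSqDbarEnd φ B w =
      ∑ j, ∑ K, ∑ L, Complex.normSq (dbarMatrix j (endMatrix φ B) w K L) := by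
  simp only [HermitianMetric.normSqDbarEnd, hg, dualMatrix, inv_one, Matrix.transpose_one,
    multiMinor_one, Matrix.one_apply, ite_mul, one_mul, zero_mul, Finset.sum_ite_eq',
    Finset.sum_ite_eq, Finset.sum_ite_irrel, Finset.sum_const_zero, Finset.mem_univ, if_true,
    Complex.mul_conj, Complex.re_sum, Complex.ofReal_re]
  rfl

/-- A double sum supported on the row and the column through `I`, off the diagonal. -/
theorem sum_sum_eq_of_cross {n : Type*} [Fintype n] [DecidableEq n] {f : n → n → ℝ} {I : n}
    (h : ∀ K L, K ≠ I → L ≠ I → f K L = 0) (hI : f I I = 0) :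
    ∑ K, ∑ L, f K L = ∑ J ∈ Finset.univ.erase I, (f I J + f J I) := by
  rw [← Finset.add_sum_erase _ _ (Finset.mem_univ I),
    ← Finset.add_sum_erase _ (f I) (Finset.mem_univ I), hI, zero_add, Finset.sum_add_distrib]
  congr 1
  refine Finset.sum_congr rfl fun K hK => ?_
  exact Finset.sum_eq_single I (fun L _ hL => h K L (Finset.ne_of_mem_erase hK) hL) (by simp)

end Norms

/-! ### The top eigenline in coordinates -/

section Coordinates

open Filter Topology

variable {d p : ℕ} {M : Type*} [TopologicalSpace M] [ChartedSpace (ModelSpace d) M]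
  (g : HermitianMetric d M) {A : ∀ x : M, End ℂ (HolForm d p x)}
  {φ : OpenPartialHomeomorph M (ModelSpace d)} {w : ModelSpace d}

/-- In coordinates the projection `P` onto a simple top eigenline satisfies `a P = τ P = P a` and
`P² = P`. The first two hold because `P` is a multiple of the adjugate of `τ - a`, a singular
matrix. -/
theorem endMatrix_topEigenspace_spec (hsa : g.IsFibrewiseSelfAdjoint A) (hφ : IsHolChart φ)
    (hw : w ∈ φ.target) (hsimple : finrank ℂ (topEigenspace (A (φ.symm w))) = 1) :
    let P := endMatrix φ (g.charSection fun x => topEigenspace (A x)) w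
    let τ : ℂ := (topEigenvalue (A (φ.symm w)) : ℂ)
    endMatrix φ A w * P = τ • P ∧ P * endMatrix φ A w = τ • P ∧ P * P = P := by
  intro P τ
  set a := endMatrix φ A w with ha
  obtain ⟨hroot, hder⟩ := (g.finrank_eigenspace_eq_one_iff_of_selfAdjoint (hsa _) _).1 hsimple
  have hP : P = LinearMap.toMatrix (coordFormBasis p hφ hw) (coordFormBasis p hφ hw)
      (lineProj (g.inner (φ.symm w)) (tangentBasis (φ.symm w)) (topEigenspace (A (φ.symm w)))) :=
    endMatrix_eq_toMatrix hφ hw _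
  have hdet : (Matrix.scalar _ τ - a).det = 0 := by
    rw [← Matrix.eval_charpoly, charpoly_endMatrix hφ hw]
    exact hroot
  have hadj := g.adjugate_scalar_sub_toMatrix_lineProj (hsa _) hsimple (coordFormBasis p hφ hw)
  rw [← endMatrix_eq_toMatrix hφ hw, ← hP] at hadj
  have hscalar : Matrix.scalar (MultiIndex d p) τ = τ • 1 := by
    rw [Matrix.scalar_apply, Matrix.smul_one_eq_diagonal]
  refine ⟨?_, ?_, ?_⟩
  · have h := Matrix.mul_adjugate (Matrix.scalar _ τ - a)
    rw [hdet, zero_smul, hadj, Matrix.mul_smul, smul_eq_zero_iff_right hder, Matrix.sub_mul,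
      sub_eq_zero, hscalar, Matrix.smul_mul, Matrix.one_mul] at h
    exact h.symm
  · have h := Matrix.adjugate_mul (Matrix.scalar _ τ - a)
    rw [hdet, zero_smul, hadj, Matrix.smul_mul, smul_eq_zero_iff_right hder, Matrix.mul_sub,
      sub_eq_zero, hscalar, Matrix.mul_smul, Matrix.mul_one] at h
    exact h.symm
  · rw [hP, ← LinearMap.toMatrix_mul, (g.isIdempotentElem_lineProj hsimple).eq]

section Diagonal

variable {lam : MultiIndex d p → ℝ} {I : MultiIndex d p}

/-- Where the matrix of `A` is diagonal, the top eigenvalue is the largest diagonal entry. -/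
theorem topEigenvalue_eq_of_endMatrix_eq_diagonal (hsa : g.IsFibrewiseSelfAdjoint A)
    (hφ : IsHolChart φ) (hw : w ∈ φ.target)
    (hdiag : endMatrix φ A w = Matrix.diagonal fun K => (lam K : ℂ))
    (hI : ∀ K, lam K ≤ lam I) : topEigenvalue (A (φ.symm w)) = lam I := by
  have hchar (t : ℂ) : (A (φ.symm w)).charpoly.eval t = ∏ K, (t - lam K) := by
    rw [← charpoly_endMatrix hφ hw, hdiag, Matrix.eval_charpoly, Matrix.scalar_apply,
      Matrix.diagonal_sub, Matrix.det_diagonal]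
  apply le_antisymm
  · have h := g.charpoly_eval_topEigenvalue (hsa (φ.symm w)) I
    rw [hchar, Finset.prod_eq_zero_iff] at h
    obtain ⟨K, -, hK⟩ := h
    rw [Complex.ofReal_inj.1 (sub_eq_zero.1 hK)]
    exact hI K
  · have h : (A (φ.symm w)).charpoly.eval (lam I : ℂ) = 0 := by
      rw [hchar, Finset.prod_eq_zero (Finset.mem_univ I) (sub_self _)]
    simpa using (g.charpoly_root_real_le (hsa _) h).2

theorem coordFormBasis_mem_eigenspace (hφ : IsHolChart φ) (hw : w ∈ φ.target)
    (hdiag : endMatrix φ A w = Matrix.diagonal fun K => (lam K : ℂ)) (J : MultiIndex d p) :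
    coordFormBasis p hφ hw J ∈ (A (φ.symm w)).eigenspace (lam J : ℂ) := by
  rw [End.mem_eigenspace_iff]
  apply (coordFormBasis p hφ hw).repr.injective
  ext K
  rw [endMatrix_eq_toMatrix hφ hw] at hdiag
  have h := congrFun (congrFun hdiag K) J
  rw [LinearMap.toMatrix_apply, Matrix.diagonal_apply] at h
  rw [h, map_smul, Basis.repr_self, Finsupp.smul_apply, Finsupp.single_apply]
  by_cases hKJ : K = J
  · simp [hKJ]
  · simp [hKJ, Ne.symm hKJ]

/-- If the eigenspace of `λ_I` is a line, then no other diagonal entry equals `λ_I`. -/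
theorem lam_ne_of_finrank_eq_one (hφ : IsHolChart φ) (hw : w ∈ φ.target)
    (hdiag : endMatrix φ A w = Matrix.diagonal fun K => (lam K : ℂ))
    (hfin : finrank ℂ ((A (φ.symm w)).eigenspace (lam I : ℂ)) = 1) {J : MultiIndex d p}
    (hJ : J ≠ I) : lam I - lam J ≠ 0 := by
  intro h
  have hJm := coordFormBasis_mem_eigenspace hφ hw hdiag J
  rw [← sub_eq_zero.1 h] at hJm
  have hI0 := (coordFormBasis p hφ hw).ne_zero I
  obtain ⟨c, hc⟩ := (finrank_eq_one_iff_of_nonzero'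
    (⟨_, coordFormBasis_mem_eigenspace hφ hw hdiag I⟩ : (A (φ.symm w)).eigenspace (lam I : ℂ))
    (fun h => hI0 (congrArg Subtype.val h))).1 hfin ⟨_, hJm⟩
  have hc' : c • coordFormBasis p hφ hw I = coordFormBasis p hφ hw J := congrArg Subtype.val hc
  have h2 := congrArg (fun η => (coordFormBasis p hφ hw).repr η J) hc'
  simp [hJ.symm] at h2

theorem formPairing_coordFormBasis (hφ : IsHolChart φ) (hw : w ∈ φ.target)
    (hg : g.coordMatrix φ w = 1) (K L : MultiIndex d p) :
    formPairing (g.inner (φ.symm w)) (tangentBasis (φ.symm w)) (coordFormBasis p hφ hw K)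
      (coordFormBasis p hφ hw L) = if K = L then 1 else 0 := by
  have hgram : gramOf (g.inner (φ.symm w)) (coordBasis hφ hw) = 1 := by
    rw [← hg]
    ext i j
    simp only [gramOf, HermitianMetric.coordMatrix, coordBasis_apply]
  rw [formPairing_basis_independent _ _ (coordBasis hφ hw), formPairing_of_gramOf_eq_one hgram]
  simp only [coordFormBasis, ← formBasis_repr, Basis.repr_self, Finsupp.single_apply]
  simp [apply_ite, eq_comm]

theorem endMatrix_charSection_eq_single (hφ : IsHolChart φ) (hw : w ∈ φ.target)
    (hg : g.coordMatrix φ w = 1) {F : ∀ x : M, Submodule ℂ (HolForm d p x)}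
    (hfin : finrank ℂ (F (φ.symm w)) = 1) (hmem : coordFormBasis p hφ hw I ∈ F (φ.symm w)) :
    endMatrix φ (g.charSection F) w = Matrix.single I I 1 := by
  ext K L
  rw [endMatrix_eq_toMatrix hφ hw, LinearMap.toMatrix_apply, HermitianMetric.charSection,
    lineProj_eq _ _ _ hfin _ hmem ((coordFormBasis p hφ hw).ne_zero I), rankOneProj_apply,
    formPairing_coordFormBasis g hφ hw hg, formPairing_coordFormBasis g hφ hw hg, if_pos rfl,
    div_one, map_smul, Basis.repr_self, Finsupp.smul_apply, Finsupp.single_apply,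
    Matrix.single_apply]
  by_cases h1 : I = K <;> by_cases h2 : I = L <;> simp [h1, h2, eq_comm]

end Diagonal

/-- The locus where the top eigenvalue is simple is open; a multi-index `I` exists as soon as
`Λ^{p,0}` is nonzero. -/
theorem isOpen_setOf_finrank_topEigenspace_eq_one [IsManifold 𝓘(ℂ, ModelSpace d) ω M]
    (hA : SmoothEndOn A Set.univ) (hsa : g.IsFibrewiseSelfAdjoint A) (I : MultiIndex d p) :
    IsOpen {x : M | finrank ℂ (topEigenspace (A x)) = 1} := by
  rw [isOpen_iff_mem_nhds]
  intro x hx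
  set ψ := chartAt (ModelSpace d) x with hψ
  have hxs : x ∈ ψ.source := mem_chart_source _ x
  have hx' : finrank ℂ (topEigenspace (A (ψ.symm (ψ x)))) = 1 := by rwa [ψ.left_inv hxs]
  have h := (contDiffAt_charSection_topEigenspace g hA hsa
    (IsManifold.chart_mem_maximalAtlas x) (ψ.map_source hxs) hx' I).1
  filter_upwards [(ψ.continuousAt hxs).eventually h, ψ.open_source.mem_nhds hxs] with y hy hys
  rwa [ψ.left_inv hys] at hy

end Coordinates

end

theorem mainTheorem4 (d p : ℕ) {M : Type*} [TopologicalSpace M] [ChartedSpace (ModelSpace d) M]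
    [IsManifold 𝓘(ℂ, ModelSpace d) ω M] (g : HermitianMetric d M)
    (A : ∀ x : M, End ℂ (HolForm d p x)) (hA : SmoothEndOn A Set.univ)
    (hsa : g.IsFibrewiseSelfAdjoint A)
    (z₀ : M) (hsimple : finrank ℂ (topEigenspace (A z₀)) = 1)
    (φ : OpenPartialHomeomorph M (ModelSpace d)) (hφ : IsHolChart φ) (hz₀ : z₀ ∈ φ.source)
    (hg : ∀ i j : Fin d, g.coordMatrix φ (φ z₀) i j = if i = j then 1 else 0)
    (lam : MultiIndex d p → ℝ)
    (hdiag : ∀ K L : MultiIndex d p,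
      endCoeff φ A K L (φ z₀) = if K = L then (lam K : ℂ) else 0)
    (I : MultiIndex d p) (hI : ∀ K : MultiIndex d p, lam K ≤ lam I) :
    (∃ U : Set M, IsOpen U ∧ z₀ ∈ U ∧ (∀ x ∈ U, finrank ℂ (topEigenspace (A x)) = 1) ∧
      SmoothEndOn (g.charSection fun x => topEigenspace (A x)) U) ∧
    g.normSqDbarEnd φ (g.charSection fun x => topEigenspace (A x)) (φ z₀) =
      ∑ J ∈ Finset.univ.erase I, ((lam I - lam J) ^ 2)⁻¹ *
        (g.normSqDbar φ (endCoeff φ A I J) (φ z₀) + g.normSqDbar φ (endCoeff φ A J I) (φ z₀)) := by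
  refine ⟨⟨{x | finrank ℂ (topEigenspace (A x)) = 1},
    isOpen_setOf_finrank_topEigenspace_eq_one g hA hsa I, hsimple, fun x hx => hx,
    fun ψ hψ K L w hw => ((contDiffAt_charSection_topEigenspace g hA hsa hψ hw.1 hw.2
      I).2.2 K L).contDiffWithinAt⟩, ?_⟩
  obtain ⟨w₀, hw₀, rfl⟩ : ∃ w ∈ φ.target, φ.symm w = z₀ :=
    ⟨φ z₀, φ.map_source hz₀, φ.left_inv hz₀⟩
  rw [φ.right_inv hw₀] at hg hdiag ⊢
  have hn : (∞ : WithTop ℕ∞) ≠ 0 := by simp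
  have hg1 : g.coordMatrix φ w₀ = 1 := by
    ext i j
    rw [hg, Matrix.one_apply]
  have ha₀ : endMatrix φ A w₀ = Matrix.diagonal fun K => (lam K : ℂ) := by
    ext K L
    rw [Matrix.diagonal_apply]
    exact hdiag K L
  have hτ₀ := topEigenvalue_eq_of_endMatrix_eq_diagonal g hsa hφ hw₀ ha₀ hI
  have hfin : finrank ℂ ((A (φ.symm w₀)).eigenspace (lam I : ℂ)) = 1 := by
    rw [← hτ₀]
    exact hsimple
  have hmem : coordFormBasis p hφ hw₀ I ∈ topEigenspace (A (φ.symm w₀)) := by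
    rw [topEigenspace, hτ₀]
    exact coordFormBasis_mem_eigenspace hφ hw₀ ha₀ I
  have hlam (J : MultiIndex d p) (hJ : J ≠ I) : (lam I : ℂ) - lam J ≠ 0 := by
    exact_mod_cast lam_ne_of_finrank_eq_one hφ hw₀ ha₀ hfin hJ
  obtain ⟨hone, hτs, hPs⟩ := contDiffAt_charSection_topEigenspace g hA hsa hφ hw₀ hsimple I
  have hspec := (hone.and (φ.open_target.mem_nhds hw₀)).mono fun w hw =>
    endMatrix_topEigenspace_spec g hsa hφ hw.2 hw.1
  have hcross (j : Fin d) := dbarMatrix_projection j (a := endMatrix φ A)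
    (P := endMatrix φ (g.charSection fun x => topEigenspace (A x)))
    (fun K L => (hA.contDiffAt hφ hw₀ K L).differentiableAt hn)
    (fun K L => (hPs K L).differentiableAt hn) (hτs.differentiableAt hn)
    (hspec.mono fun w h => h.1) (hspec.mono fun w h => h.2.1) (hspec.mono fun w h => h.2.2)
    ha₀ (endMatrix_charSection_eq_single g hφ hw₀ hg1 hsimple hmem) (by rw [hτ₀]) hlam
  have hentry (j : Fin d) (J : MultiIndex d p) (z : ℂ) :
      Complex.normSq (((lam I : ℂ) - lam J)⁻¹ * z) =
        ((lam I - lam J) ^ 2)⁻¹ * Complex.normSq z := by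
    rw [map_mul, map_inv₀, ← Complex.ofReal_sub, Complex.normSq_ofReal, sq]
  rw [normSqDbarEnd_of_coordMatrix_eq_one g hg1]
  simp only [normSqDbar_of_coordMatrix_eq_one g hg1]
  calc _ = ∑ j, ∑ J ∈ Finset.univ.erase I, ((lam I - lam J) ^ 2)⁻¹ *
        (Complex.normSq (dbar j (endCoeff φ A I J) w₀) +
          Complex.normSq (dbar j (endCoeff φ A J I) w₀)) := by
        refine Finset.sum_congr rfl fun j _ => ?_
        obtain ⟨hcol, hrow, hoff, hII⟩ := hcross j
        rw [sum_sum_eq_of_cross (I := I) (fun K L hK hL => by rw [hoff K L hK hL, map_zero])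
          (by rw [hII, map_zero])]
        refine Finset.sum_congr rfl fun J hJ => ?_
        rw [hrow J (Finset.ne_of_mem_erase hJ), hcol J (Finset.ne_of_mem_erase hJ), hentry j,
          hentry j, ← mul_add]
        rfl
    _ = _ := by
        rw [Finset.sum_comm]
        refine Finset.sum_congr rfl fun J _ => ?_
        rw [← Finset.mul_sum, Finset.sum_add_distrib]
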